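/- Identify the group of Möbius transformations of $\hat{\mathbb C}=\mathbb C\cup\{\infty\}$ with $PSL(2,\mathbb C)$. A circle in $\hat{\mathbb C}$ is a Euclidean circle or a Euclidean line together with $\infty$; its complement in $\hat{\mathbb C}$ has two components, and for each circle considered one of them is chosen as its interior, the other being its exterior. A subgroup $G$ of $PSL(2,\mathbb C)$ is called marked classical T-Schottky on the generators $g_1,\dots,g_n$ if $G=\langle g_1,\dots,g_n\rangle$ and there are $2n$ circles $C_1,C_1',\dots,C_n,C_n'$ in $\hat{\mathbb C}$, with chosen interiors, such that the $2n$ interiors are pairwise disjoint (tangencies of the circles are allowed) and each $g_i$ maps the exterior of $C_i$ onto the interior of $C_i'$. The group $G$ is called classical T-Schottky if it is marked classical T-Schottky on some finite system of generators $g_1,\dots,g_n$ (with $n$ arbitrary). Theorem 6.7. Let $S,T\in PSL(2,\mathbb C)$ be parabolic with distinct fixed points in $\hat{\mathbb C}$ (equivalently, $G=\langle S,T\rangle$ is non-elementary). Then $G=\langle S,T\rangle$ is marked classical T-Schottky on the generators $S,T$ if and only if $G$ is classical T-Schottky. -/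

import Mathlib

/-- The group `PSL(2, ℂ)` of Möbius transformations. -/
abbrev Moebius : Type := Matrix.ProjectiveSpecialLinearGroup (Fin 2) ℂ

/-- The action of Möbius transformations on the Riemann sphere `ℂ ∪ {∞}`, transported from the
action of `PSL(2, ℂ)` on the complex projective line. -/
noncomputable instance Moebius.instMulAction : MulAction Moebius (OnePoint ℂ) :=
  (OnePoint.equivProjectivization ℂ).mulAction Moebius

/-- The class of `A ∈ SL(2, ℂ)` acts by the usual formula `z ↦ (a z + b) / (c z + d)`. -/
theorem Moebius.mk_smul (A : Matrix.SpecialLinearGroup (Fin 2) ℂ) (z : OnePoint ℂ) :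
    (QuotientGroup.mk A : Moebius) • z = (A : Matrix.GeneralLinearGroup (Fin 2) ℂ) • z :=
  rfl

/-- A Möbius transformation is parabolic if it is represented by a parabolic matrix
(non-scalar, with a double eigenvalue; that is, not the identity and of squared trace `4`). -/
def Moebius.IsParabolic (g : Moebius) : Prop :=
  ∃ A : Matrix.SpecialLinearGroup (Fin 2) ℂ,
    (QuotientGroup.mk A : Moebius) = g ∧ (A : Matrix (Fin 2) (Fin 2) ℂ).IsParabolic

/-- A circle in the Riemann sphere, with a choice of which of its two sides is the interior.
The circle is the zero set of `a |z|² + 2 Re (conj b * z) + c`, where `a c < |b|²`: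
for `a ≠ 0` it is the Euclidean circle with centre `-b / a` and radius
`√(|b|² - a c) / |a| > 0`, and for `a = 0` (hence `b ≠ 0`) it is a line together with `∞`. -/
structure OrientedCircle where
  a : ℝ
  b : ℂ
  c : ℝ
  nondegenerate : a * c < Complex.normSq b

namespace OrientedCircle

/-- The defining function of the circle; only its sign at `∞` is meaningful, and it is
the sign of `a`. -/
noncomputable def form (C : OrientedCircle) (z : OnePoint ℂ) : ℝ :=
  z.elim C.a fun w => C.a * Complex.normSq w + 2 * (starRingEnd ℂ C.b * w).re + C.c

/-- The interior: the open side on which the defining function is negative. -/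
def interior (C : OrientedCircle) : Set (OnePoint ℂ) := {z | C.form z < 0}

/-- The exterior: the other open side. -/
def exterior (C : OrientedCircle) : Set (OnePoint ℂ) := {z | 0 < C.form z}

end OrientedCircle

/-- Circles `C i`, `C' i` and Möbius transformations `g i` form a classical T-Schottky
configuration: the interiors of the `2n` circles are pairwise disjoint (the circles themselves
may be tangent), and each `g i` maps the exterior of `C i` onto the interior of `C' i`. -/
structure IsClassicalTSchottkyConfiguration {n : ℕ} (C C' : Fin n → OrientedCircle)
    (g : Fin n → Moebius) : Prop where
  disjoint_interiors : Pairwise fun p q : Fin n ⊕ Fin n =>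
    Disjoint (Sum.elim C C' p).interior (Sum.elim C C' q).interior
  side_pairing : ∀ i, (fun z => g i • z) '' (C i).exterior = (C' i).interior

/-- `G` is a marked classical T-Schottky group on the generators `g 0, …, g (n - 1)`. -/
def IsMarkedClassicalTSchottky (G : Subgroup Moebius) {n : ℕ} (g : Fin n → Moebius) : Prop :=
  G = Subgroup.closure (Set.range g) ∧
    ∃ C C' : Fin n → OrientedCircle, IsClassicalTSchottkyConfiguration C C' g

/-- `G` is a classical T-Schottky group: it is marked classical T-Schottky on some finite
system of generators. -/
def IsClassicalTSchottky (G : Subgroup Moebius) : Prop :=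
  ∃ (n : ℕ) (g : Fin n → Moebius), IsMarkedClassicalTSchottky G g

/-! Only one direction has content. Let side pairings `g i` generate the group. Since `S` and `T` do
not commute, there are at least two of them, and ping-pong makes them free. A free group generated
by two elements has rank at most two, so there are exactly two side pairings `a`, `b`, and `S`, `T`
are images of a generating pair `s`, `t` of the free group.

Up to conjugacy `s` and `t` are cyclically reduced words, repeated periodically. If such a word of a
parabolic element contains consecutive letters `u⁻¹ v`, a conjugate of the element maps the exterior
of the circle of `u` into the interior of the circle of `v`, so its fixed point lies on both circles
(`form_fixedPoint_eq_zero`). In the presence of a third disc two circles touch at most once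
(`touching_point_unique`). Hence if both words contained the same turn `{u, v}`, conjugates of `S`
and `T` would share their fixed point and commute. This is impossible: the exponent sums of `s` and
`t` have determinant `±1`, those of commuting elements have determinant `0`. Disjointness of the
turns and the unit determinant force one word to be a single letter (`exists_eq_letter`). Up to
conjugation, inversion and exchange, `S = a` and `T = b aⁿ` (`exists_eq_of_closure_eq_top`).

For `n = 0` nothing is left to prove. For `|n| ≥ 2` the touching argument gives `S` and `T` a common
fixed point, which is excluded. For `n = ±1` the pair is normalised to `z + k` and `z / (z + 1)`. A
configuration for `(a, b)` then forces `4 ≤ ‖k‖ + |Im k|` (`four_le_of_isSchottkyPair_transl`), and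
this inequality suffices to draw circles for `(a, b a)` (`isSchottkyPair_transl_unitParabolic`). -/

section

open Matrix

/-! ### Möbius transformations acting on oriented circles. -/

namespace OrientedCircle

/-- The Hermitian form on `ℂ²` whose sign at `(z, 1)` and `(1, 0)` is the sign of `form`. -/
noncomputable def herm (C : OrientedCircle) (u v : ℂ) : ℝ :=
  C.a * Complex.normSq u + 2 * (starRingEnd ℂ C.b * u * starRingEnd ℂ v).re + C.c * Complex.normSq v

theorem herm_mul (C : OrientedCircle) (t u v : ℂ) :
    C.herm (t * u) (t * v) = Complex.normSq t * C.herm u v := by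
  simp only [herm, Complex.normSq_apply, Complex.mul_re, Complex.mul_im, Complex.conj_re,
    Complex.conj_im]
  ring

@[simp] theorem form_infty (C : OrientedCircle) : C.form OnePoint.infty = C.a := rfl

theorem form_coe (C : OrientedCircle) (w : ℂ) :
    C.form (w : OnePoint ℂ) = C.a * Complex.normSq w + 2 * (starRingEnd ℂ C.b * w).re + C.c := rfl

theorem form_coe_re_im (C : OrientedCircle) (w : ℂ) :
    C.form (w : OnePoint ℂ) =
      C.a * (w.re * w.re + w.im * w.im) + 2 * (C.b.re * w.re + C.b.im * w.im) + C.c := by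
  rw [form_coe]
  simp [Complex.normSq_apply]

theorem form_coe_eq_herm (C : OrientedCircle) (w : ℂ) : C.form (w : OnePoint ℂ) = C.herm w 1 := by
  simp [form_coe, herm]

theorem form_infty_eq_herm (C : OrientedCircle) : C.form OnePoint.infty = C.herm 1 0 := by
  simp [herm]

/-- The circle with the opposite side as its interior. -/
def flip (C : OrientedCircle) : OrientedCircle where
  a := -C.a
  b := -C.b
  c := -C.c
  nondegenerate := by simpa using C.nondegenerate

theorem form_flip (C : OrientedCircle) (z : OnePoint ℂ) : C.flip.form z = -C.form z := by
  induction z using OnePoint.rec with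
  | infty => rfl
  | coe w => simp only [form_coe_re_im, flip, Complex.neg_re, Complex.neg_im]; ring

theorem interior_flip (C : OrientedCircle) : C.flip.interior = C.exterior := by
  ext z
  simp [interior, exterior, form_flip]

theorem exterior_flip (C : OrientedCircle) : C.flip.exterior = C.interior := by
  ext z
  simp [interior, exterior, form_flip]

/-- The preimage of a circle under the Möbius transformation of a matrix. -/
noncomputable def comapSL (C : OrientedCircle) (A : SpecialLinearGroup (Fin 2) ℂ) :
    OrientedCircle where
  a := C.herm (A 0 0) (A 1 0)
  b := C.a * starRingEnd ℂ (A 0 0) * A 0 1 + starRingEnd ℂ C.b * A 0 1 * starRingEnd ℂ (A 1 0) +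
    C.b * starRingEnd ℂ (A 0 0) * A 1 1 + C.c * starRingEnd ℂ (A 1 0) * A 1 1
  c := C.herm (A 0 1) (A 1 1)
  nondegenerate := by
    have hdet : A 0 0 * A 1 1 - A 0 1 * A 1 0 = 1 := by
      rw [← Matrix.det_fin_two]; exact A.det_coe
    have hn : Complex.normSq (A 0 0 * A 1 1 - A 0 1 * A 1 0) = 1 := by rw [hdet]; simp
    have hC := C.nondegenerate
    generalize A 0 0 = p at *
    generalize A 0 1 = q at *
    generalize A 1 0 = r at *
    generalize A 1 1 = s at *
    -- The discriminant of a Hermitian form is multiplied by `|det A|²`, which is `1` here.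
    have key : Complex.normSq (C.a * starRingEnd ℂ p * q + starRingEnd ℂ C.b * q * starRingEnd ℂ r +
        C.b * starRingEnd ℂ p * s + C.c * starRingEnd ℂ r * s) - C.herm p r * C.herm q s =
        (Complex.normSq C.b - C.a * C.c) * Complex.normSq (p * s - q * r) := by
      simp only [herm, Complex.normSq_apply, Complex.mul_re, Complex.mul_im, Complex.conj_re,
        Complex.conj_im, Complex.add_re, Complex.add_im, Complex.sub_re, Complex.sub_im,
        Complex.ofReal_re, Complex.ofReal_im]
      ring
    rw [hn, mul_one] at key
    linarith

theorem herm_comapSL (C : OrientedCircle) (A : SpecialLinearGroup (Fin 2) ℂ) (u v : ℂ) :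
    (C.comapSL A).herm u v = C.herm (A 0 0 * u + A 0 1 * v) (A 1 0 * u + A 1 1 * v) := by
  simp only [comapSL, herm, Complex.normSq_apply, Complex.mul_re, Complex.mul_im, Complex.conj_re,
    Complex.conj_im, Complex.add_re, Complex.add_im, Complex.ofReal_re, Complex.ofReal_im]
  ring

theorem form_div_eq_herm (C : OrientedCircle) (u : ℂ) {v : ℂ} (hv : v ≠ 0) :
    C.herm u v = Complex.normSq v * C.form ((u / v : ℂ) : OnePoint ℂ) := by
  rw [form_coe_eq_herm, ← herm_mul, mul_div_cancel₀ _ hv, mul_one]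

/-- `form` is `herm` at the normalised vectors `(z, 1)` and `(1, 0)`. The matrix sends such a vector
to a multiple of a normalised one, and `r` is the squared modulus of that multiple. -/
theorem form_comapSL (C : OrientedCircle) (A : SpecialLinearGroup (Fin 2) ℂ) (z : OnePoint ℂ) :
    ∃ r : ℝ, 0 < r ∧
      (C.comapSL A).form z = r * C.form ((QuotientGroup.mk A : Moebius) • z) := by
  have hdet : A 0 0 * A 1 1 - A 0 1 * A 1 0 = 1 := by
    rw [← Matrix.det_fin_two]; exact A.det_coe
  rw [Moebius.mk_smul]
  induction z using OnePoint.rec with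
  | infty =>
    rw [form_infty_eq_herm, herm_comapSL, OnePoint.smul_infty_eq_ite]
    simp only [mul_one, mul_zero, add_zero]
    by_cases h : A 1 0 = 0
    · have h0 : A 0 0 ≠ 0 := by rintro h0; simp [h, h0] at hdet
      refine ⟨Complex.normSq (A 0 0), Complex.normSq_pos.2 h0, ?_⟩
      have := C.herm_mul (A 0 0) 1 0
      simp only [mul_one, mul_zero] at this
      simp [h, this, form_infty_eq_herm C, - form_infty]
    · exact ⟨_, Complex.normSq_pos.2 h, by simpa [h] using C.form_div_eq_herm _ h⟩
  | coe w =>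
    rw [form_coe_eq_herm, herm_comapSL, OnePoint.smul_some_eq_ite]
    simp only [mul_one]
    by_cases h : A 1 0 * w + A 1 1 = 0
    · have h0 : A 0 0 * w + A 0 1 ≠ 0 := by
        intro h0
        have : A 0 0 * (A 1 0 * w + A 1 1) - A 1 0 * (A 0 0 * w + A 0 1) = 1 := by
          linear_combination hdet
        simp [h, h0] at this
      refine ⟨Complex.normSq (A 0 0 * w + A 0 1), Complex.normSq_pos.2 h0, ?_⟩
      have := C.herm_mul (A 0 0 * w + A 0 1) 1 0
      simp only [mul_one, mul_zero] at this
      simp [h, this, form_infty_eq_herm C, - form_infty]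
    · exact ⟨_, Complex.normSq_pos.2 h, by simpa [h] using C.form_div_eq_herm _ h⟩

/-- The preimage of a circle under a Möbius transformation. -/
noncomputable def comap (C : OrientedCircle) (h : Moebius) : OrientedCircle :=
  C.comapSL (Quotient.out h)

theorem form_comap (C : OrientedCircle) (h : Moebius) (z : OnePoint ℂ) :
    ∃ r : ℝ, 0 < r ∧ (C.comap h).form z = r * C.form (h • z) := by
  have := C.form_comapSL (Quotient.out h) z
  rwa [QuotientGroup.out_eq'] at this

theorem mem_interior {C : OrientedCircle} {z : OnePoint ℂ} : z ∈ C.interior ↔ C.form z < 0 :=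
  Iff.rfl

theorem mem_exterior {C : OrientedCircle} {z : OnePoint ℂ} : z ∈ C.exterior ↔ 0 < C.form z :=
  Iff.rfl

theorem mem_interior_comap {C : OrientedCircle} {h : Moebius} {z : OnePoint ℂ} :
    z ∈ (C.comap h).interior ↔ h • z ∈ C.interior := by
  obtain ⟨r, hr, e⟩ := C.form_comap h z
  simp only [mem_interior, e]
  exact ⟨fun H => by nlinarith, fun H => by nlinarith⟩

theorem mem_exterior_comap {C : OrientedCircle} {h : Moebius} {z : OnePoint ℂ} :
    z ∈ (C.comap h).exterior ↔ h • z ∈ C.exterior := by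
  obtain ⟨r, hr, e⟩ := C.form_comap h z
  simp only [mem_exterior, e]
  exact ⟨fun H => (mul_pos_iff_of_pos_left hr).1 H, fun H => by positivity⟩

theorem form_comap_eq_zero {C : OrientedCircle} {h : Moebius} {z : OnePoint ℂ} :
    (C.comap h).form z = 0 ↔ C.form (h • z) = 0 := by
  obtain ⟨r, hr, e⟩ := C.form_comap h z
  rw [e, mul_eq_zero, or_iff_right hr.ne']

theorem disjoint_comap {C D : OrientedCircle} (h : Moebius)
    (H : Disjoint C.interior D.interior) :
    Disjoint (C.comap h).interior (D.comap h).interior := by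
  rw [Set.disjoint_left] at H ⊢
  intro z hz
  rw [mem_interior_comap] at hz ⊢
  exact H hz

end OrientedCircle

/-! ### Explicit transformations and the normal form of a pair of parabolics. -/

namespace Moebius

/-- The matrix with the given entries, as an element of `SL(2, ℂ)`. -/
def matrixOf (a b c d : ℂ) (h : a * d - b * c = 1) : SpecialLinearGroup (Fin 2) ℂ :=
  ⟨!![a, b; c, d], by rw [Matrix.det_fin_two_of, h]⟩

/-- The Möbius transformation `z ↦ (a z + b) / (c z + d)`. -/
def ofEntries (a b c d : ℂ) (h : a * d - b * c = 1) : Moebius :=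
  QuotientGroup.mk (matrixOf a b c d h)

theorem ofEntries_smul_infty (a b c d : ℂ) (h : a * d - b * c = 1) :
    ofEntries a b c d h • (OnePoint.infty : OnePoint ℂ) =
      if c = 0 then OnePoint.infty else ((a / c : ℂ) : OnePoint ℂ) := by
  rw [ofEntries, mk_smul, OnePoint.smul_infty_eq_ite]
  rfl

theorem ofEntries_smul_coe (a b c d : ℂ) (h : a * d - b * c = 1) (w : ℂ) :
    ofEntries a b c d h • (w : OnePoint ℂ) =
      if c * w + d = 0 then OnePoint.infty
      else (((a * w + b) / (c * w + d) : ℂ) : OnePoint ℂ) := by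
  rw [ofEntries, mk_smul, OnePoint.smul_some_eq_ite]
  rfl

theorem matrixOf_mul {a b c d a' b' c' d' : ℂ} (h : a * d - b * c = 1)
    (h' : a' * d' - b' * c' = 1) :
    matrixOf a b c d h * matrixOf a' b' c' d' h' =
      matrixOf (a * a' + b * c') (a * b' + b * d') (c * a' + d * c') (c * b' + d * d')
        (by linear_combination h * (a' * d' - b' * c') + h') := by
  apply Subtype.ext
  change !![a, b; c, d] * !![a', b'; c', d'] = !![_, _; _, _]
  rw [Matrix.mul_fin_two]

theorem ofEntries_mul {a b c d a' b' c' d' : ℂ} (h : a * d - b * c = 1)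
    (h' : a' * d' - b' * c' = 1) :
    ofEntries a b c d h * ofEntries a' b' c' d' h' =
      ofEntries (a * a' + b * c') (a * b' + b * d') (c * a' + d * c') (c * b' + d * d')
        (by linear_combination h * (a' * d' - b' * c') + h') := by
  rw [ofEntries, ofEntries, ofEntries, ← matrixOf_mul h h']
  rfl

theorem ofEntries_neg {a b c d : ℂ} (h : a * d - b * c = 1) :
    ofEntries (-a) (-b) (-c) (-d) (by linear_combination h) = ofEntries a b c d h := by
  have hJ : ofEntries (-1) 0 0 (-1) (by norm_num) = 1 := by
    rw [ofEntries, QuotientGroup.eq_one_iff, Matrix.SpecialLinearGroup.mem_center_iff]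
    refine ⟨-1, by simp, ?_⟩
    change _ = !![(-1 : ℂ), 0; 0, -1]
    ext i j
    fin_cases i <;> fin_cases j <;> simp
  rw [← one_mul (ofEntries a b c d h), ← hJ, ofEntries_mul]
  simp

@[simp] theorem ofEntries_one : ofEntries 1 0 0 1 (by simp) = 1 := by
  rw [ofEntries, QuotientGroup.eq_one_iff]
  convert Subgroup.one_mem _
  apply Subtype.ext
  exact Matrix.one_fin_two.symm

theorem eq_ofEntries (A : SpecialLinearGroup (Fin 2) ℂ) :
    (QuotientGroup.mk A : Moebius) = ofEntries (A 0 0) (A 0 1) (A 1 0) (A 1 1)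
      (by rw [← Matrix.det_fin_two]; exact A.det_coe) := by
  rw [ofEntries]
  congr 1
  apply Subtype.ext
  exact Matrix.eta_fin_two A.1

/-- The translation `z ↦ z + k`. -/
def transl (k : ℂ) : Moebius := ofEntries 1 k 0 1 (by simp)

/-- The parabolic transformation `z ↦ z / (z + 1)` fixing `0`. -/
def unitParabolic : Moebius := ofEntries 1 0 1 1 (by simp)

@[simp] theorem transl_smul_infty (k : ℂ) :
    transl k • (OnePoint.infty : OnePoint ℂ) = OnePoint.infty := by
  simp [transl, ofEntries_smul_infty]

@[simp] theorem transl_smul_coe (k w : ℂ) :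
    transl k • (w : OnePoint ℂ) = ((w + k : ℂ) : OnePoint ℂ) := by
  simp [transl, ofEntries_smul_coe]

theorem transl_mul (k l : ℂ) : transl k * transl l = transl (k + l) := by
  simp [transl, ofEntries_mul, add_comm]

theorem unitParabolic_smul_coe (w : ℂ) (hw : w + 1 ≠ 0) :
    unitParabolic • (w : OnePoint ℂ) = ((w / (w + 1) : ℂ) : OnePoint ℂ) := by
  simp [unitParabolic, ofEntries_smul_coe, hw]

theorem exists_smul_infty_eq (z : OnePoint ℂ) :
    ∃ h : Moebius, h • (OnePoint.infty : OnePoint ℂ) = z := by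
  induction z using OnePoint.rec with
  | infty => exact ⟨1, one_smul _ _⟩
  | coe w => exact ⟨ofEntries w (-1) 1 0 (by simp), by simp [ofEntries_smul_infty]⟩

theorem exists_smul_infty_eq_smul_zero_eq {p q : OnePoint ℂ} (hpq : p ≠ q) :
    ∃ h : Moebius, h • (OnePoint.infty : OnePoint ℂ) = p ∧ h • ((0 : ℂ) : OnePoint ℂ) = q := by
  obtain ⟨h, rfl⟩ := exists_smul_infty_eq p
  have : h⁻¹ • q ≠ OnePoint.infty := fun e => hpq (by rw [← e, smul_inv_smul])
  obtain ⟨w, hw⟩ := OnePoint.ne_infty_iff_exists.1 this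
  refine ⟨h * transl w, by simp [mul_smul], ?_⟩
  rw [mul_smul, transl_smul_coe, zero_add, hw, smul_inv_smul]

theorem isParabolic_transl {k : ℂ} (hk : k ≠ 0) : (transl k).IsParabolic := by
  refine ⟨_, rfl, (Matrix.isParabolic_iff_of_upperTriangular rfl).2 ⟨rfl, hk⟩⟩

theorem transl_inv (k : ℂ) : (transl k)⁻¹ = transl (-k) := by
  rw [inv_eq_iff_mul_eq_one, transl_mul, add_neg_cancel]
  exact ofEntries_one

namespace IsParabolic

theorem conj {g : Moebius} (hg : g.IsParabolic) (h : Moebius) : (h * g * h⁻¹).IsParabolic := by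
  obtain ⟨A, rfl, hA⟩ := hg
  obtain ⟨B, rfl⟩ := QuotientGroup.mk_surjective h
  refine ⟨B * A * B⁻¹, rfl, ?_⟩
  have := (Matrix.isParabolic_conj_iff (B : GL (Fin 2) ℂ) (m := (A : Matrix (Fin 2) (Fin 2) ℂ))).2 hA
  simpa [Matrix.inv_def] using this

theorem eq_transl {g : Moebius} (hg : g.IsParabolic)
    (h : g • (OnePoint.infty : OnePoint ℂ) = OnePoint.infty) : ∃ k ≠ 0, g = transl k := by
  obtain ⟨A, rfl, hA⟩ := hg
  rw [mk_smul, OnePoint.smul_infty_eq_self_iff] at h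
  replace h : A 1 0 = 0 := h
  obtain ⟨h1, h2⟩ := (Matrix.isParabolic_iff_of_upperTriangular h).1 hA
  have hdet : A 0 0 * A 1 1 - A 0 1 * A 1 0 = 1 := by
    rw [← Matrix.det_fin_two]; exact A.det_coe
  rw [h, mul_zero, sub_zero, ← h1] at hdet
  rw [eq_ofEntries A]
  rcases mul_self_eq_one_iff.1 hdet with h0 | h0
  · exact ⟨A 0 1, h2, by simp only [transl, ← h1, h0, h]⟩
  · refine ⟨-A 0 1, neg_ne_zero.2 h2, ?_⟩
    rw [← ofEntries_neg]
    simp only [transl, ← h1, h0, h, neg_neg, neg_zero]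

theorem exists_fixedPoint {g : Moebius} (hg : g.IsParabolic) : ∃ p : OnePoint ℂ, g • p = p := by
  obtain ⟨A, rfl, hA⟩ := hg
  exact ⟨_, (Matrix.GeneralLinearGroup.IsParabolic.smul_eq_self_iff
    (g := (A : GL (Fin 2) ℂ)) hA).2 rfl⟩

theorem eq_conj_transl {g : Moebius} (hg : g.IsParabolic) {h : Moebius}
    (hp : g • h • (OnePoint.infty : OnePoint ℂ) = h • OnePoint.infty) :
    ∃ k ≠ 0, g = h * transl k * h⁻¹ := by
  obtain ⟨k, hk, e⟩ := (hg.conj h⁻¹).eq_transl (by simp [mul_smul, hp])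
  exact ⟨k, hk, by rw [← e]; group⟩

theorem inv {g : Moebius} (hg : g.IsParabolic) : (g⁻¹).IsParabolic := by
  obtain ⟨p, hp⟩ := hg.exists_fixedPoint
  obtain ⟨h, rfl⟩ := exists_smul_infty_eq p
  obtain ⟨k, hk, rfl⟩ := hg.eq_conj_transl hp
  rw [conj_inv, transl_inv]
  exact (isParabolic_transl (neg_ne_zero.2 hk)).conj h

theorem fixedPoint_unique {g : Moebius} (hg : g.IsParabolic) {p q : OnePoint ℂ} (hp : g • p = p)
    (hq : g • q = q) : p = q := by
  obtain ⟨A, rfl, hA⟩ := hg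
  exact ((Matrix.GeneralLinearGroup.IsParabolic.smul_eq_self_iff
    (g := (A : GL (Fin 2) ℂ)) hA).1 hp).trans ((Matrix.GeneralLinearGroup.IsParabolic.smul_eq_self_iff
    (g := (A : GL (Fin 2) ℂ)) hA).1 hq).symm

theorem commute {g₁ g₂ : Moebius} (h₁ : g₁.IsParabolic) (h₂ : g₂.IsParabolic) {p : OnePoint ℂ}
    (e₁ : g₁ • p = p) (e₂ : g₂ • p = p) : Commute g₁ g₂ := by
  obtain ⟨h, rfl⟩ := exists_smul_infty_eq p
  obtain ⟨k, -, rfl⟩ := h₁.eq_conj_transl e₁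
  obtain ⟨l, -, rfl⟩ := h₂.eq_conj_transl e₂
  have : transl k * transl l = transl l * transl k := by rw [transl_mul, transl_mul, add_comm]
  exact Commute.conj this h

/-- Two parabolic transformations without common fixed point are simultaneously conjugate to a
translation and `z ↦ z / (z + 1)`. -/
theorem exists_normal_form {S T : Moebius} (hS : S.IsParabolic) (hT : T.IsParabolic)
    (hST : ∀ z : OnePoint ℂ, ¬ (S • z = z ∧ T • z = z)) :
    ∃ (h : Moebius) (k : ℂ), S = h * transl k * h⁻¹ ∧ T = h * unitParabolic * h⁻¹ := by
  obtain ⟨p, hp⟩ := hS.exists_fixedPoint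
  obtain ⟨q, hq⟩ := hT.exists_fixedPoint
  have hpq : p ≠ q := by rintro rfl; exact hST p ⟨hp, hq⟩
  obtain ⟨h, rfl, rfl⟩ := exists_smul_infty_eq_smul_zero_eq hpq
  obtain ⟨k, -, rfl⟩ := hS.eq_conj_transl hp
  set J : Moebius := ofEntries 0 (-1) 1 0 (by norm_num) with hJ
  have hJ0 : J • (OnePoint.infty : OnePoint ℂ) = ((0 : ℂ) : OnePoint ℂ) := by
    simp [hJ, ofEntries_smul_infty]
  obtain ⟨l, hl, rfl⟩ := hT.eq_conj_transl (h := h * J) (by rw [mul_smul, hJ0, hq])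
  -- `J * transl l * J⁻¹` is `z / (1 - l z)`. Conjugation by the scaling `z ↦ c² z` with `c² = -1 /
  -- l` turns it into `z / (z + 1)`.
  obtain ⟨c, hc⟩ := IsAlgClosed.exists_pow_nat_eq (-l⁻¹) (n := 2) (by norm_num)
  have hc0 : c ≠ 0 := by rintro rfl; simp [hl] at hc
  have hlc : l * c = -c⁻¹ := by
    field_simp
    field_simp at hc
    linear_combination hc
  set D : Moebius := ofEntries c 0 0 c⁻¹ (by field_simp; ring) with hD
  have e1 : transl k * D = D * transl (k * (c⁻¹) ^ 2) := by
    simp only [hD, transl, ofEntries_mul]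
    congr 1 <;> field_simp <;> ring
  have hJJ : J⁻¹ = J := by
    rw [inv_eq_iff_mul_eq_one, hJ, ofEntries_mul, ← ofEntries_neg]
    simp
  have e2 : J * transl l * J⁻¹ * D = D * unitParabolic := by
    rw [hJJ]
    simp only [hD, hJ, transl, unitParabolic, ofEntries_mul]
    rw [← ofEntries_neg]
    simp [hlc]
  refine ⟨h * D, k * (c⁻¹) ^ 2, ?_, ?_⟩
  · rw [mul_assoc h D, ← e1]; group
  · rw [mul_assoc h D, ← e2]; group

end IsParabolic

end Moebius

end

/-! ### Disjoint discs, tangency and parabolic fixed points. -/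

section

open Matrix

theorem eventually_quadratic_neg {A : ℝ} (hA : A < 0) (B C : ℝ) :
    ∀ᶠ t : ℝ in Filter.atTop, A * t ^ 2 + B * t + C < 0 := by
  filter_upwards [Filter.eventually_ge_atTop 1,
    Filter.eventually_gt_atTop ((|B| + |C|) / (-A))] with t h1 h2
  rw [div_lt_iff₀ (by linarith)] at h2
  nlinarith [le_abs_self B, le_abs_self C, abs_nonneg C]

namespace OrientedCircle

theorem normSq_b_pos {C : OrientedCircle} (h : C.a = 0) : 0 < Complex.normSq C.b := by
  simpa [h] using C.nondegenerate

theorem interior_nonempty (C : OrientedCircle) : C.interior.Nonempty := by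
  have hC := C.nondegenerate
  rcases lt_trichotomy C.a 0 with h | h | h
  · exact ⟨OnePoint.infty, h⟩
  · have hb := normSq_b_pos h
    refine ⟨((-(((|C.c| + 1) / Complex.normSq C.b : ℝ) : ℂ) * C.b : ℂ) : OnePoint ℂ), ?_⟩
    rw [mem_interior, form_coe_re_im, h]
    have e : (|C.c| + 1) / Complex.normSq C.b * (C.b.re * C.b.re + C.b.im * C.b.im) = |C.c| + 1 := by
      rw [← Complex.normSq_apply, div_mul_cancel₀ _ hb.ne']
    simp only [Complex.mul_re, Complex.mul_im, Complex.neg_re, Complex.neg_im, Complex.ofReal_re,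
      Complex.ofReal_im]
    have := le_abs_self C.c
    have := abs_nonneg C.c
    nlinarith
  · refine ⟨((-((C.a⁻¹ : ℝ) : ℂ) * C.b : ℂ) : OnePoint ℂ), ?_⟩
    rw [mem_interior, form_coe_re_im]
    simp only [Complex.mul_re, Complex.mul_im, Complex.neg_re, Complex.neg_im, Complex.ofReal_re,
      Complex.ofReal_im]
    rw [Complex.normSq_apply] at hC
    have e : C.c < C.a⁻¹ * (C.b.re * C.b.re + C.b.im * C.b.im) := by
      rw [inv_mul_eq_div, lt_div_iff₀ h]; linarith
    have h1 : C.a * C.a⁻¹ = 1 := mul_inv_cancel₀ h.ne'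
    generalize C.a⁻¹ = i at *
    have : C.a * ((-i * C.b.re - -0 * C.b.im) * (-i * C.b.re - -0 * C.b.im) +
        (-i * C.b.im + -0 * C.b.re) * (-i * C.b.im + -0 * C.b.re)) =
        (C.a * i) * i * (C.b.re * C.b.re + C.b.im * C.b.im) := by ring
    rw [this, h1]
    linarith

/-- An open disc disjoint from another misses its boundary too. With the bad point moved to `∞`, `Y`
is a half-plane and the interior of `X` contains a neighbourhood of `∞`; far out along the normal
`-Y.b` they meet. -/
theorem interior_subset_exterior {X Y : OrientedCircle} (H : Disjoint X.interior Y.interior) :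
    X.interior ⊆ Y.exterior := by
  intro z hz
  by_contra hz'
  have h0 : Y.form z = 0 := by
    refine le_antisymm (not_lt.1 hz') (not_lt.1 fun h => ?_)
    exact Set.disjoint_left.1 H hz h
  obtain ⟨h, rfl⟩ := Moebius.exists_smul_infty_eq z
  have H' := disjoint_comap h H
  replace hz := mem_interior_comap.2 hz
  replace h0 := form_comap_eq_zero.2 h0
  generalize X.comap h = X at *
  generalize Y.comap h = Y at *
  rw [mem_interior, form_infty] at hz
  rw [form_infty] at h0
  have hb := normSq_b_pos h0
  obtain ⟨t, h1, h2⟩ := ((eventually_quadratic_neg (mul_neg_of_neg_of_pos hz hb)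
    (-2 * (X.b.re * Y.b.re + X.b.im * Y.b.im)) X.c).and
    (Filter.eventually_gt_atTop (Y.c / (2 * Complex.normSq Y.b)))).exists
  rw [div_lt_iff₀ (by positivity), Complex.normSq_apply] at h2
  rw [Complex.normSq_apply] at h1
  refine Set.Nonempty.not_disjoint ⟨((-(t : ℂ) * Y.b : ℂ) : OnePoint ℂ), ?_, ?_⟩ H'
  · rw [mem_interior, form_coe_re_im]
    simp only [Complex.mul_re, Complex.mul_im, Complex.neg_re, Complex.neg_im, Complex.ofReal_re,
      Complex.ofReal_im]
    linarith
  · rw [mem_interior, form_coe_re_im, h0]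
    simp only [Complex.mul_re, Complex.mul_im, Complex.neg_re, Complex.neg_im, Complex.ofReal_re,
      Complex.ofReal_im]
    linarith

theorem exterior_subset_exterior {X Y : OrientedCircle} (H : X.interior ⊆ Y.interior) :
    Y.exterior ⊆ X.exterior := by
  rw [← interior_flip Y]
  apply interior_subset_exterior
  rw [interior_flip, Set.disjoint_left]
  intro z hz hz'
  exact lt_asymm (mem_exterior.1 hz) (H hz')

/-- Complementation reverses inclusions; passing from closed complements to open sides is
`exterior_subset_exterior`. -/
theorem smul_inv_mem_interior {D E : OrientedCircle} {g : Moebius}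
    (H : ∀ z ∈ E.exterior, g • z ∈ D.interior) {z : OnePoint ℂ} (hz : z ∈ D.exterior) :
    g⁻¹ • z ∈ E.interior := by
  have : E.flip.interior ⊆ (D.comap g).interior := by
    intro z hz
    rw [interior_flip] at hz
    exact mem_interior_comap.2 (H z hz)
  have := exterior_subset_exterior this (mem_exterior_comap.2 (by rwa [smul_inv_smul]))
  rwa [exterior_flip] at this

/-- Two circles of a family of three with disjoint interiors touch in at most one point. -/
theorem touching_point_unique {X Y Z : OrientedCircle} (hXY : Disjoint X.interior Y.interior)
    (hZX : Disjoint Z.interior X.interior) (hZY : Disjoint Z.interior Y.interior)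
    {p q : OnePoint ℂ} (hXp : X.form p = 0) (hYp : Y.form p = 0) (hXq : X.form q = 0)
    (hYq : Y.form q = 0) : p = q := by
  by_contra hpq
  obtain ⟨h, rfl, rfl⟩ := Moebius.exists_smul_infty_eq_smul_zero_eq hpq
  replace hXY := disjoint_comap h hXY
  replace hZX := interior_subset_exterior (disjoint_comap h hZX)
  replace hZY := interior_subset_exterior (disjoint_comap h hZY)
  replace hXp := form_comap_eq_zero.2 hXp
  replace hXq := form_comap_eq_zero.2 hXq
  replace hYp := form_comap_eq_zero.2 hYp
  replace hYq := form_comap_eq_zero.2 hYq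
  generalize X.comap h = X at *
  generalize Y.comap h = Y at *
  obtain ⟨z, hz⟩ := (Z.comap h).interior_nonempty
  replace hZX := mem_exterior.1 (hZX hz)
  replace hZY := mem_exterior.1 (hZY hz)
  rw [form_infty] at hXp hYp
  simp only [form_coe_re_im, Complex.zero_re, Complex.zero_im, mul_zero, add_zero, zero_add]
    at hXq hYq
  induction z using OnePoint.rec with
  | infty => exact hZX.ne' hXp
  | coe w =>
    -- With `p = ∞` and `q = 0` both forms are real linear. They are positive at the point `w` of
    -- the third disc, so both are negative at `-w`.
    refine Set.Nonempty.not_disjoint ⟨((-w : ℂ) : OnePoint ℂ), ?_, ?_⟩ hXY <;>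
    · simp only [form_coe_re_im, mem_interior, hXp, hYp, hXq, hYq, Complex.neg_re,
        Complex.neg_im] at *
      linarith

/-- With the fixed point at `∞`, a positive value there would make the interior a bounded disc, and
no bounded nonempty set is preserved by a translation. -/
theorem form_fixedPoint_nonpos {D : OrientedCircle} {g : Moebius} (hg : g.IsParabolic)
    {p : OnePoint ℂ} (hp : g • p = p) (H : ∀ z ∈ D.interior, g • z ∈ D.interior) :
    D.form p ≤ 0 := by
  by_contra! hpos
  obtain ⟨h, rfl⟩ := Moebius.exists_smul_infty_eq p
  obtain ⟨k, hk, rfl⟩ := hg.eq_conj_transl hp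
  replace hpos := mem_exterior_comap.2 hpos
  replace H : ∀ z ∈ (D.comap h).interior, Moebius.transl k • z ∈ (D.comap h).interior := by
    intro z hz
    rw [mem_interior_comap] at hz ⊢
    have := H _ hz
    rwa [mul_smul, mul_smul, inv_smul_smul] at this
  generalize D.comap h = D at *
  rw [mem_exterior, form_infty] at hpos
  obtain ⟨z, hz⟩ := D.interior_nonempty
  induction z using OnePoint.rec with
  | infty => exact lt_asymm hz hpos
  | coe w =>
    have hn : ∀ n : ℕ, ((w + n * k : ℂ) : OnePoint ℂ) ∈ D.interior := by
      intro n
      induction n with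
      | zero => simpa using hz
      | succ n ih =>
        have := H _ ih
        rw [Moebius.transl_smul_coe] at this
        convert this using 2
        push_cast
        ring
    have hk' := Complex.normSq_pos.2 hk
    have hA : -(D.a * Complex.normSq k) < 0 := by
      have := mul_pos hpos hk'
      linarith
    obtain ⟨n, h1⟩ := (tendsto_natCast_atTop_atTop.eventually (eventually_quadratic_neg hA
      (-(2 * D.a * (w.re * k.re + w.im * k.im) + 2 * (D.b.re * k.re + D.b.im * k.im)))
      (-(D.form w)))).exists
    have h2 := hn n
    rw [mem_interior, form_coe_re_im] at h2
    rw [form_coe_re_im, Complex.normSq_apply] at h1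
    simp only [Complex.add_re, Complex.add_im, Complex.mul_re, Complex.mul_im, Complex.natCast_re,
      Complex.natCast_im] at h2
    linarith

/-- `g` maps the interior of `D` into itself and `g⁻¹` that of `E`, so the fixed point lies in both
closed discs. As the open discs are disjoint, these meet only along the two circles. -/
theorem form_fixedPoint_eq_zero {D E : OrientedCircle} {g : Moebius} (hg : g.IsParabolic)
    {p : OnePoint ℂ} (hp : g • p = p) (hDE : Disjoint D.interior E.interior)
    (H : ∀ z ∈ E.exterior, g • z ∈ D.interior) : D.form p = 0 ∧ E.form p = 0 := by
  have h1 := interior_subset_exterior hDE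
  have h2 := interior_subset_exterior hDE.symm
  have hD : D.form p ≤ 0 := form_fixedPoint_nonpos hg hp fun z hz => H z (h1 hz)
  have hE : E.form p ≤ 0 := form_fixedPoint_nonpos hg.inv (inv_smul_eq_iff.2 hp.symm) fun z hz =>
    smul_inv_mem_interior H (h2 hz)
  refine ⟨le_antisymm hD (not_lt.1 fun h => ?_), le_antisymm hE (not_lt.1 fun h => ?_)⟩
  · exact absurd (mem_exterior.1 (h1 h)) (not_lt.2 hE)
  · exact absurd (mem_exterior.1 (h2 h)) (not_lt.2 hD)

end OrientedCircle

/-! ### Schottky pairs under exchange, inversion and conjugation. -/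

/-- `S` and `T` pair the sides of four circles with disjoint interiors. -/
def IsSchottkyPair (S T : Moebius) : Prop :=
  ∃ C C' : Fin 2 → OrientedCircle, IsClassicalTSchottkyConfiguration C C' ![S, T]

theorem isSchottkyPair_iff {S T : Moebius} : IsSchottkyPair S T ↔
    ∃ A A' B B' : OrientedCircle, Disjoint A.interior A'.interior ∧
      Disjoint A.interior B.interior ∧ Disjoint A.interior B'.interior ∧
      Disjoint A'.interior B.interior ∧ Disjoint A'.interior B'.interior ∧
      Disjoint B.interior B'.interior ∧ (fun z => S • z) '' A.exterior = A'.interior ∧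
      (fun z => T • z) '' B.exterior = B'.interior := by
  constructor
  · rintro ⟨C, C', h, h'⟩
    refine ⟨C 0, C' 0, C 1, C' 1, ?_, ?_, ?_, ?_, ?_, ?_, h' 0, h' 1⟩
    · exact h (i := .inl 0) (j := .inr 0) (by simp)
    · exact h (i := .inl 0) (j := .inl 1) (by simp)
    · exact h (i := .inl 0) (j := .inr 1) (by simp)
    · exact h (i := .inr 0) (j := .inl 1) (by simp)
    · exact h (i := .inr 0) (j := .inr 1) (by simp)
    · exact h (i := .inl 1) (j := .inr 1) (by simp)
  · rintro ⟨A, A', B, B', h1, h2, h3, h4, h5, h6, hS, hT⟩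
    refine ⟨![A, B], ![A', B'], ?_, ?_⟩
    · rintro (i | i) (j | j) hij <;> fin_cases i <;> fin_cases j <;>
        first
        | exact absurd rfl hij
        | assumption
        | (rw [disjoint_comm]; assumption)
    · intro i
      fin_cases i
      · exact hS
      · exact hT

namespace IsSchottkyPair

variable {S T : Moebius}

theorem swap (h : IsSchottkyPair S T) : IsSchottkyPair T S := by
  rw [isSchottkyPair_iff] at h ⊢
  obtain ⟨A, A', B, B', h1, h2, h3, h4, h5, h6, hS, hT⟩ := h
  exact ⟨B, B', A, A', h6, h2.symm, h4.symm, h3.symm, h5.symm, h1, hT, hS⟩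

theorem image_inv_exterior {g : Moebius} {A A' : OrientedCircle}
    (h : (fun z => g • z) '' A.exterior = A'.interior) :
    (fun z => g⁻¹ • z) '' A'.exterior = A.interior := by
  apply Set.Subset.antisymm
  · rintro _ ⟨z, hz, rfl⟩
    exact OrientedCircle.smul_inv_mem_interior
      (fun z hz => h ▸ Set.mem_image_of_mem (fun z => g • z) hz) hz
  · intro z hz
    refine ⟨g • z, ?_, by simp⟩
    have H : ∀ w ∈ A'.flip.exterior, g⁻¹ • w ∈ A.flip.interior := by
      intro w hw
      rw [OrientedCircle.exterior_flip, ← h] at hw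
      obtain ⟨u, hu, rfl⟩ := hw
      rw [OrientedCircle.interior_flip]
      simpa using hu
    have := OrientedCircle.smul_inv_mem_interior H (z := z) (by rwa [OrientedCircle.exterior_flip])
    rwa [inv_inv, OrientedCircle.interior_flip] at this

theorem inv_left (h : IsSchottkyPair S T) : IsSchottkyPair S⁻¹ T := by
  rw [isSchottkyPair_iff] at h ⊢
  obtain ⟨A, A', B, B', h1, h2, h3, h4, h5, h6, hS, hT⟩ := h
  exact ⟨A', A, B, B', h1.symm, h4, h5, h2, h3, h6, image_inv_exterior hS, hT⟩

theorem inv_right (h : IsSchottkyPair S T) : IsSchottkyPair S T⁻¹ := h.swap.inv_left.swap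

theorem image_comap {g h : Moebius} {A A' : OrientedCircle}
    (H : (fun z => g • z) '' A.exterior = A'.interior) :
    (fun z => (h⁻¹ * g * h) • z) '' (A.comap h).exterior = (A'.comap h).interior := by
  ext z
  rw [OrientedCircle.mem_interior_comap, ← H]
  constructor
  · rintro ⟨w, hw, rfl⟩
    exact ⟨h • w, OrientedCircle.mem_exterior_comap.1 hw, by simp [mul_smul]⟩
  · rintro ⟨w, hw, e⟩
    refine ⟨h⁻¹ • w, OrientedCircle.mem_exterior_comap.2 (by simpa using hw), ?_⟩
    simp only [mul_smul, smul_inv_smul] at e ⊢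
    rw [e, inv_smul_smul]

theorem conj (H : IsSchottkyPair S T) (h : Moebius) :
    IsSchottkyPair (h⁻¹ * S * h) (h⁻¹ * T * h) := by
  rw [isSchottkyPair_iff] at H ⊢
  obtain ⟨A, A', B, B', h1, h2, h3, h4, h5, h6, hS, hT⟩ := H
  exact ⟨A.comap h, A'.comap h, B.comap h, B'.comap h, OrientedCircle.disjoint_comap h h1,
    OrientedCircle.disjoint_comap h h2, OrientedCircle.disjoint_comap h h3,
    OrientedCircle.disjoint_comap h h4, OrientedCircle.disjoint_comap h h5,
    OrientedCircle.disjoint_comap h h6, image_comap hS, image_comap hT⟩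

end IsSchottkyPair

end

/-! ### Circles for `z + k` and `z / (z + 1)`. -/

section

open Matrix

namespace OrientedCircle

theorem image_exterior_of_comapSL {M : SpecialLinearGroup (Fin 2) ℂ} {A A' : OrientedCircle}
    (ha : (A'.comapSL M).a = -A.a) (hb : (A'.comapSL M).b = -A.b) (hc : (A'.comapSL M).c = -A.c) :
    (fun z => (QuotientGroup.mk M : Moebius) • z) '' A.exterior = A'.interior := by
  have key : ∀ z : OnePoint ℂ,
      z ∈ A.exterior ↔ (QuotientGroup.mk M : Moebius) • z ∈ A'.interior := by
    intro z
    obtain ⟨r, hr, e⟩ := A'.form_comapSL M z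
    have : (A'.comapSL M).form z = -A.form z := by
      rw [← form_flip]
      induction z using OnePoint.rec with
      | infty => exact ha
      | coe w => simp only [form_coe_re_im, ha, hb, hc, flip]
    rw [this] at e
    rw [mem_exterior, mem_interior]
    exact ⟨fun h => by nlinarith, fun h => by nlinarith⟩
  ext z
  constructor
  · rintro ⟨w, hw, rfl⟩
    exact (key w).1 hw
  · intro hz
    exact ⟨(QuotientGroup.mk M : Moebius)⁻¹ • z, (key _).2 (by rwa [smul_inv_smul]),
      smul_inv_smul _ _⟩

end OrientedCircle

/-- The disc has radius `1 / p ≤ W / 2` and centre on the axis `v = 0`, hence fits into the strip.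
-/
theorem abs_le_of_mem_tangent_disc {p W u v : ℝ} (hp : 0 < p) (hW : 2 ≤ p * W)
    (h : p / 2 * (u * u + v * v) + u < 0) : -(W / 2) ≤ v ∧ v ≤ W / 2 := by
  have h1 : (p * u + 1) ^ 2 + (p * v) ^ 2 < 1 := by nlinarith
  have h2 : (p * v) ^ 2 < 1 := by nlinarith [sq_nonneg (p * u + 1)]
  obtain ⟨h3, h4⟩ := abs_lt.1 ((sq_lt_one_iff_abs_lt_one _).1 h2)
  constructor <;> nlinarith

/-- The translation pairs the half-planes outside the strip `|Im (m z)| < W / 2`. The other map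
pairs two discs of radius `1 / Re m` tangent at `0`: in the coordinate `1 / z` they are half-planes
at distance `Re m`, matched by the unit translation. They fit into the strip because `2 ≤ W * Re m`.
-/
theorem isSchottkyPair_of_unit {k m : ℂ} (hm : m.re * m.re + m.im * m.im = 1) (hp : 0 < m.re)
    (hW : 2 ≤ m.re * (m * k).im) : IsSchottkyPair (Moebius.transl k) Moebius.unitParabolic := by
  set W := (m * k).im with hWdef
  rw [Complex.mul_im] at hWdef
  have hW0 : 0 < W := by
    by_contra! h
    nlinarith
  have hr : ∀ z : ℂ, z.re * z.re + z.im * z.im = (m.re * z.re - m.im * z.im) *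
      (m.re * z.re - m.im * z.im) + (m.re * z.im + m.im * z.re) * (m.re * z.im + m.im * z.re) := by
    intro z
    linear_combination (-(z.re * z.re + z.im * z.im)) * hm
  rw [isSchottkyPair_iff]
  refine ⟨⟨0, ⟨m.im / 2, m.re / 2⟩, W / 2, ?_⟩, ⟨0, ⟨-m.im / 2, -m.re / 2⟩, W / 2, ?_⟩,
    ⟨m.re / 2, ⟨m.re / 2, -m.im / 2⟩, 0, ?_⟩, ⟨m.re / 2, ⟨-m.re / 2, m.im / 2⟩, 0, ?_⟩,
    ?_, ?_, ?_, ?_, ?_, ?_, ?_, ?_⟩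
  · simp only [Complex.normSq_apply]; nlinarith
  · simp only [Complex.normSq_apply]; nlinarith
  · simp only [Complex.normSq_apply]; nlinarith
  · simp only [Complex.normSq_apply]; nlinarith
  · rw [Set.disjoint_left]
    intro z h1 h2
    rw [OrientedCircle.mem_interior] at h1 h2
    induction z using OnePoint.rec with
    | infty => exact lt_irrefl _ h1
    | coe z =>
      simp only [OrientedCircle.form_coe_re_im] at h1 h2
      linarith
  · rw [Set.disjoint_left]
    intro z h1 h2
    rw [OrientedCircle.mem_interior] at h1 h2
    induction z using OnePoint.rec with
    | infty => exact lt_irrefl _ h1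
    | coe z =>
      simp only [OrientedCircle.form_coe_re_im, hr z] at h1 h2
      have := abs_le_of_mem_tangent_disc (u := m.re * z.re - m.im * z.im)
        (v := m.re * z.im + m.im * z.re) hp hW (by linarith)
      linarith
  · rw [Set.disjoint_left]
    intro z h1 h2
    rw [OrientedCircle.mem_interior] at h1 h2
    induction z using OnePoint.rec with
    | infty => exact lt_irrefl _ h1
    | coe z =>
      simp only [OrientedCircle.form_coe_re_im, hr z] at h1 h2
      have := abs_le_of_mem_tangent_disc (u := -(m.re * z.re - m.im * z.im))
        (v := m.re * z.im + m.im * z.re) hp hW (by linarith)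
      linarith
  · rw [Set.disjoint_left]
    intro z h1 h2
    rw [OrientedCircle.mem_interior] at h1 h2
    induction z using OnePoint.rec with
    | infty => exact lt_irrefl _ h1
    | coe z =>
      simp only [OrientedCircle.form_coe_re_im, hr z] at h1 h2
      have := abs_le_of_mem_tangent_disc (u := m.re * z.re - m.im * z.im)
        (v := m.re * z.im + m.im * z.re) hp hW (by linarith)
      linarith
  · rw [Set.disjoint_left]
    intro z h1 h2
    rw [OrientedCircle.mem_interior] at h1 h2
    induction z using OnePoint.rec with
    | infty => exact lt_irrefl _ h1
    | coe z =>
      simp only [OrientedCircle.form_coe_re_im, hr z] at h1 h2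
      have := abs_le_of_mem_tangent_disc (u := -(m.re * z.re - m.im * z.im))
        (v := m.re * z.im + m.im * z.re) hp hW (by linarith)
      linarith
  · rw [Set.disjoint_left]
    intro z h1 h2
    rw [OrientedCircle.mem_interior] at h1 h2
    induction z using OnePoint.rec with
    | infty => rw [OrientedCircle.form_infty] at h1; simp only at h1; linarith
    | coe z =>
      simp only [OrientedCircle.form_coe_re_im] at h1 h2
      nlinarith [mul_self_nonneg z.re, mul_self_nonneg z.im]
  · apply OrientedCircle.image_exterior_of_comapSL
    · simp [OrientedCircle.comapSL, Moebius.matrixOf, OrientedCircle.herm]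
    · apply Complex.ext <;>
        simp [OrientedCircle.comapSL, Moebius.matrixOf, OrientedCircle.herm] <;> ring
    · simp [OrientedCircle.comapSL, Moebius.matrixOf, OrientedCircle.herm]
      linarith
  · apply OrientedCircle.image_exterior_of_comapSL
    · simp [OrientedCircle.comapSL, Moebius.matrixOf, OrientedCircle.herm]
      ring
    · apply Complex.ext <;>
        simp [OrientedCircle.comapSL, Moebius.matrixOf, OrientedCircle.herm] <;> ring
    · simp [OrientedCircle.comapSL, Moebius.matrixOf, OrientedCircle.herm]

/-- For `|m| = 1` one has `Re m * Im (m k) = (Im (m² k) + Im k) / 2`. The choice `m² k = i ‖k‖`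
maximises this to `(‖k‖ + Im k) / 2`. -/
theorem isSchottkyPair_transl_unitParabolic_of_im {k : ℂ} (hk : 4 ≤ ‖k‖ + k.im) :
    IsSchottkyPair (Moebius.transl k) Moebius.unitParabolic := by
  have hk0 : k ≠ 0 := by rintro rfl; norm_num at hk
  have hn : (‖k‖ : ℂ) ≠ 0 := by simpa using hk0
  obtain ⟨m, hm⟩ := IsAlgClosed.exists_pow_nat_eq (Complex.I * ‖k‖ / k) (n := 2) (by norm_num)
  have h1 : m * m * k = Complex.I * ‖k‖ := by
    rw [← sq, hm]; field_simp
  have h2 : ‖m‖ = 1 := by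
    have : ‖m‖ ^ 2 = 1 := by
      rw [← norm_pow, hm]; simp [hk0]
    nlinarith [norm_nonneg m]
  have h3 : m.re * m.re + m.im * m.im = 1 := by
    rw [← Complex.normSq_apply, Complex.normSq_eq_norm_sq, h2, one_pow]
  have h4 : (m * m * k).im = ‖k‖ := by rw [h1]; simp
  have h5 : 2 ≤ m.re * (m * k).im := by
    simp only [Complex.mul_im, Complex.mul_re] at h4 ⊢
    have : m.re * (m.re * k.im + m.im * k.re) = (‖k‖ + k.im) / 2 := by
      linear_combination h4 / 2 + k.im * h3 / 2
    linarith
  rcases lt_trichotomy m.re 0 with h | h | h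
  · refine isSchottkyPair_of_unit (m := -m) (by simpa using h3) (by simpa using h) ?_
    simpa only [neg_mul, Complex.neg_re, Complex.neg_im, mul_neg, neg_neg] using h5
  · rw [h] at h5; norm_num at h5
  · exact isSchottkyPair_of_unit h3 h h5

/-- A sufficient condition for `z ↦ z + k` and `z ↦ z / (z + 1)` to pair four circles with
disjoint interiors. -/
theorem isSchottkyPair_transl_unitParabolic {k : ℂ} (hk : 4 ≤ ‖k‖ + |k.im|) :
    IsSchottkyPair (Moebius.transl k) Moebius.unitParabolic := by
  rcases le_total 0 k.im with h | h
  · rw [abs_of_nonneg h] at hk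
    exact isSchottkyPair_transl_unitParabolic_of_im hk
  · rw [abs_of_nonpos h] at hk
    have := (isSchottkyPair_transl_unitParabolic_of_im (k := -k) (by simpa using hk)).inv_left
    rwa [Moebius.transl_inv, neg_neg] at this

/-- The conclusion reduces to `16 ≤ 8 |y| + x²`, obtained from `4 - |y| ≤ x` when `|y| < 2`. -/
theorem four_le_norm_add_abs_im {h s : ℝ} {k : ℂ} (hs : h * h + s * s = 1)
    (h1 : 2 ≤ h * (h * k.re + s * k.im)) (h0 : 0 < h * k.re + s * k.im)
    (h2 : 4 * (h * k.re + s * k.im) ≤ Complex.normSq k * h) : 4 ≤ ‖k‖ + |k.im| := by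
  set x := k.re
  set y := k.im
  set w := h * x + s * y with hw
  rw [Complex.normSq_apply] at h2
  have hxy : 16 ≤ 8 * |y| + x ^ 2 := by
    by_cases hy : 2 ≤ |y|
    · nlinarith [sq_nonneg x]
    push Not at hy
    -- In the orthonormal frame `(h, s)`, `(-s, h)` the vector `k` has coordinates `w` and `τ w`.
    obtain ⟨τ, hτ⟩ : ∃ τ, τ * w = h * y - s * x := ⟨(h * y - s * x) / w, by field_simp⟩
    have hx : x = h * w - s * (τ * w) := by
      rw [hτ, hw]; linear_combination (-x) * hs
    have hy' : y = h * (τ * w) + s * w := by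
      rw [hτ, hw]; linear_combination (-y) * hs
    have hwu : x * x + y * y = w * (w * (1 + τ * τ)) := by
      rw [hx, hy']; linear_combination (w * (w * (1 + τ * τ))) * hs
    have hN : 4 ≤ h * w * (1 + τ * τ) := by
      have : w * 4 ≤ w * (h * w * (1 + τ * τ)) := by
        calc w * 4 ≤ (x * x + y * y) * h := by linarith
          _ = _ := by rw [hwu]; ring
      exact le_of_mul_le_mul_left this h0
    have hN' : 2 * (1 + τ * τ) ≤ h * w * (1 + τ * τ) :=
      mul_le_mul_of_nonneg_right h1 (by nlinarith [mul_self_nonneg τ])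
    have hxN : x = h * w * (1 + τ * τ) - τ * y := by
      rw [hy', hx]; ring
    have hτy : τ * y ≤ |τ| * |y| := by rw [← abs_mul]; exact le_abs_self _
    have hττ : τ * τ = |τ| * |τ| := (abs_mul_abs_self τ).symm
    have hge : 4 - |y| ≤ x := by
      rcases le_total |τ| 1 with hle | hle
      · nlinarith [abs_nonneg y]
      · nlinarith [mul_nonneg (sub_nonneg.2 hle) (by linarith : (0 : ℝ) ≤ 2 * |τ| + 2 - |y|)]
    nlinarith [abs_nonneg y]
  have hk : ‖k‖ ^ 2 = x * x + y * y := by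
    rw [← Complex.normSq_eq_norm_sq, Complex.normSq_apply]
  by_contra! hlt
  nlinarith [norm_nonneg k, abs_nonneg y, sq_abs y]

end

/-! ### The inequality forced by a configuration for `a` and `b` when `b a` is parabolic. -/

section

open Matrix

namespace OrientedCircle

/-- Circles through `0` with disjoint interiors have opposite normals at `0`. -/
theorem exists_b_eq_neg_mul {X Y : OrientedCircle} (hX : X.c = 0) (hY : Y.c = 0)
    (H : Disjoint X.interior Y.interior) : ∃ σ : ℝ, 0 < σ ∧ Y.b = -(σ : ℂ) * X.b := by
  have hXb : 0 < ‖X.b‖ := by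
    have := X.nondegenerate
    rw [hX, mul_zero, Complex.normSq_pos] at this
    exact norm_pos_iff.2 this
  have hYb : 0 < ‖Y.b‖ := by
    have := Y.nondegenerate
    rw [hY, mul_zero, Complex.normSq_pos] at this
    exact norm_pos_iff.2 this
  have hX2 : ‖X.b‖ ^ 2 = X.b.re * X.b.re + X.b.im * X.b.im := by
    rw [← Complex.normSq_eq_norm_sq, Complex.normSq_apply]
  have hY2 : ‖Y.b‖ ^ 2 = Y.b.re * Y.b.re + Y.b.im * Y.b.im := by
    rw [← Complex.normSq_eq_norm_sq, Complex.normSq_apply]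
  generalize ‖X.b‖ = n₁ at *
  generalize ‖Y.b‖ = n₂ at *
  set r := X.b.re * Y.b.re + X.b.im * Y.b.im with hr
  -- Otherwise a short step from `0` along the bisector `(d₁, d₂)` of the inner normals enters both
  -- discs. The inequality is the equality case of Cauchy–Schwarz for opposite vectors.
  have key : r + n₁ * n₂ ≤ 0 := by
    by_contra! hpos
    set d₁ := -(n₂ * X.b.re + n₁ * Y.b.re) with hd₁
    set d₂ := -(n₂ * X.b.im + n₁ * Y.b.im) with hd₂
    have e1 : X.b.re * d₁ + X.b.im * d₂ = -(n₁ * (r + n₁ * n₂)) := by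
      rw [hd₁, hd₂, hr]; linear_combination n₂ * hX2
    have e2 : Y.b.re * d₁ + Y.b.im * d₂ = -(n₂ * (r + n₁ * n₂)) := by
      rw [hd₁, hd₂, hr]; linear_combination n₁ * hY2
    have p1 : 0 < n₁ * (r + n₁ * n₂) := by positivity
    have p2 : 0 < n₂ * (r + n₁ * n₂) := by positivity
    obtain ⟨τ, ⟨h1, h2⟩, h3⟩ := (((Filter.eventually_gt_atTop
      (X.a * (d₁ * d₁ + d₂ * d₂) / (n₁ * (r + n₁ * n₂)))).and
      (Filter.eventually_gt_atTop (Y.a * (d₁ * d₁ + d₂ * d₂) / (n₂ * (r + n₁ * n₂))))).and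
      (Filter.eventually_gt_atTop (0 : ℝ))).exists
    rw [div_lt_iff₀ p1] at h1
    rw [div_lt_iff₀ p2] at h2
    have hi : 0 < τ⁻¹ := inv_pos.2 h3
    have hi' : τ⁻¹ * τ = 1 := inv_mul_cancel₀ h3.ne'
    generalize τ⁻¹ = i at *
    refine Set.Nonempty.not_disjoint ⟨((⟨i * d₁, i * d₂⟩ : ℂ) : OnePoint ℂ), ?_, ?_⟩ H
    · rw [mem_interior, form_coe_re_im, hX]
      have : X.a * (i * d₁ * (i * d₁) + i * d₂ * (i * d₂)) +
          2 * (X.b.re * (i * d₁) + X.b.im * (i * d₂)) + 0 =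
          i * i * (X.a * (d₁ * d₁ + d₂ * d₂)) - 2 * (i * (n₁ * (r + n₁ * n₂))) := by
        linear_combination 2 * i * e1
      rw [this]
      have h4 : i * i * (X.a * (d₁ * d₁ + d₂ * d₂)) < i * i * (τ * (n₁ * (r + n₁ * n₂))) :=
        mul_lt_mul_of_pos_left h1 (by positivity)
      have h5 : i * i * (τ * (n₁ * (r + n₁ * n₂))) = i * (n₁ * (r + n₁ * n₂)) := by
        linear_combination (i * (n₁ * (r + n₁ * n₂))) * hi'
      have : 0 < i * (n₁ * (r + n₁ * n₂)) := by positivity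
      linarith
    · rw [mem_interior, form_coe_re_im, hY]
      have : Y.a * (i * d₁ * (i * d₁) + i * d₂ * (i * d₂)) +
          2 * (Y.b.re * (i * d₁) + Y.b.im * (i * d₂)) + 0 =
          i * i * (Y.a * (d₁ * d₁ + d₂ * d₂)) - 2 * (i * (n₂ * (r + n₁ * n₂))) := by
        linear_combination 2 * i * e2
      rw [this]
      have h4 : i * i * (Y.a * (d₁ * d₁ + d₂ * d₂)) < i * i * (τ * (n₂ * (r + n₁ * n₂))) :=
        mul_lt_mul_of_pos_left h2 (by positivity)
      have h5 : i * i * (τ * (n₂ * (r + n₁ * n₂))) = i * (n₂ * (r + n₁ * n₂)) := by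
        linear_combination (i * (n₂ * (r + n₁ * n₂))) * hi'
      have : 0 < i * (n₂ * (r + n₁ * n₂)) := by positivity
      linarith
  have hsum : (n₂ * X.b.re + n₁ * Y.b.re) ^ 2 + (n₂ * X.b.im + n₁ * Y.b.im) ^ 2 ≤ 0 := by
    have : (n₂ * X.b.re + n₁ * Y.b.re) ^ 2 + (n₂ * X.b.im + n₁ * Y.b.im) ^ 2 =
        2 * (n₁ * n₂) * (r + n₁ * n₂) := by
      rw [hr]; linear_combination -n₂ ^ 2 * hX2 - n₁ ^ 2 * hY2
    rw [this]
    exact mul_nonpos_of_nonneg_of_nonpos (by positivity) key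
  have z1 : n₂ * X.b.re + n₁ * Y.b.re = 0 := by
    nlinarith [sq_nonneg (n₂ * X.b.re + n₁ * Y.b.re), sq_nonneg (n₂ * X.b.im + n₁ * Y.b.im)]
  have z2 : n₂ * X.b.im + n₁ * Y.b.im = 0 := by
    nlinarith [sq_nonneg (n₂ * X.b.re + n₁ * Y.b.re), sq_nonneg (n₂ * X.b.im + n₁ * Y.b.im)]
  refine ⟨n₂ / n₁, by positivity, ?_⟩
  apply Complex.ext
  · simp only [Complex.mul_re, Complex.neg_re, Complex.neg_im, Complex.ofReal_re,
      Complex.ofReal_im]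
    field_simp
    linarith
  · simp only [Complex.mul_im, Complex.neg_re, Complex.neg_im, Complex.ofReal_re,
      Complex.ofReal_im]
    field_simp
    linarith

end OrientedCircle

/-- Says that a disc of diameter `1 / a` fits into width `W`, without assuming `a > 0`. If `a * W <
1`, a `t` slightly above `W` contradicts the hypothesis. -/
theorem one_le_mul_of_forall {a W : ℝ} (hW : 0 ≤ W) (H : ∀ t, 0 < t → a * t < 1 → t ≤ W) :
    1 ≤ a * W := by
  by_contra! h
  have hd : 0 < (1 - a * W) / (2 * (|a| + 1)) := by
    have := abs_nonneg a
    apply div_pos <;> linarith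
  have := H (W + (1 - a * W) / (2 * (|a| + 1))) (by linarith) ?_
  · linarith
  · have h2 : a * ((1 - a * W) / (2 * (|a| + 1))) ≤
        (|a| + 1) * ((1 - a * W) / (2 * (|a| + 1))) := by
      apply mul_le_mul_of_nonneg_right _ hd.le
      linarith [le_abs_self a]
    have h3 : (|a| + 1) * ((1 - a * W) / (2 * (|a| + 1))) = (1 - a * W) / 2 := by
      have : |a| + 1 ≠ 0 := by positivity
      field_simp
    rw [mul_add]
    linarith

/-- The estimate behind the necessary condition: `a₀`, `a₁` are half the curvatures of two discs
touching the line `Re (conj e * z) = 0` at `0` from the two sides. -/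
theorem four_le_of_discs {e k : ℂ} {a₀ a₁ : ℝ} (he : e.re * e.re + e.im * e.im = 1)
    (hW : 0 ≤ e.re * k.re + e.im * k.im)
    (h₀ : 1 ≤ a₀ * (e.re * k.re + e.im * k.im)) (h₁ : 1 ≤ a₁ * (e.re * k.re + e.im * k.im))
    (hsum : a₀ + a₁ ≤ e.re)
    (hdisj : ∀ z : ℂ, a₁ * Complex.normSq z < e.re * z.re + e.im * z.im →
      ¬ a₀ * Complex.normSq (z - k) + (e.re * (z - k).re + e.im * (z - k).im) < 0) :
    4 ≤ ‖k‖ + |k.im| := by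
  have hW0 : 0 < e.re * k.re + e.im * k.im := by
    refine hW.lt_of_ne fun h => ?_
    rw [← h] at h₀; norm_num at h₀
  set W := e.re * k.re + e.im * k.im with hWdef
  have ha₀ : 0 < a₀ := by by_contra! h; nlinarith
  have ha₁ : 0 < a₁ := by by_contra! h; nlinarith
  -- The discs have centres `r₁ e` and `k - r₀ e`. Disjointness puts the centres at distance at
  -- least `R = r₀ + r₁`, that is, `2 R W ≤ |k|²`.
  have hk : (1 / a₀ + 1 / a₁) * W ≤ Complex.normSq k := by
    by_contra! hlt
    set r₀ := 1 / (2 * a₀) with hr₀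
    set r₁ := 1 / (2 * a₁) with hr₁
    have e₀ : a₀ * (2 * r₀) = 1 := by rw [hr₀]; field_simp
    have e₁ : a₁ * (2 * r₁) = 1 := by rw [hr₁]; field_simp
    have p₀ : 0 < r₀ := by positivity
    have p₁ : 0 < r₁ := by positivity
    have hlt' : Complex.normSq k - 2 * (r₀ + r₁) * W < 0 := by
      have : 1 / a₀ + 1 / a₁ = 2 * (r₀ + r₁) := by rw [hr₀, hr₁]; field_simp
      rw [this] at hlt; linarith
    set R := r₀ + r₁ with hR
    have pR : 0 < R := by positivity
    set q₁ := r₁ / R with hq₁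
    set q₀ := r₀ / R with hq₀
    have hq : q₀ + q₁ = 1 := by rw [hq₀, hq₁, ← add_div, ← hR, div_self pR.ne']
    have E₀ : q₀ * R = r₀ := div_mul_cancel₀ _ pR.ne'
    have E₁ : q₁ * R = r₁ := div_mul_cancel₀ _ pR.ne'
    have hdist : (k.re - R * e.re) ^ 2 + (k.im - R * e.im) ^ 2 < R ^ 2 := by
      rw [Complex.normSq_apply, hWdef] at hlt'
      have : (k.re - R * e.re) ^ 2 + (k.im - R * e.im) ^ 2 = k.re * k.re + k.im * k.im -
          2 * R * (e.re * k.re + e.im * k.im) + R ^ 2 := by linear_combination R ^ 2 * he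
      linarith
    have hpos₀ : 0 < q₀ := by positivity
    have hpos₁ : 0 < q₁ := by positivity
    set d₁ := k.re - R * e.re with hd₁
    set d₂ := k.im - R * e.im with hd₂
    -- The point dividing the segment between the centres in the ratio `r₁ : r₀` lies in both discs.
    refine hdisj ⟨r₁ * e.re + q₁ * d₁, r₁ * e.im + q₁ * d₂⟩ ?_ ?_
    · rw [Complex.normSq_apply]
      have : a₁ * ((r₁ * e.re + q₁ * d₁) * (r₁ * e.re + q₁ * d₁) +
          (r₁ * e.im + q₁ * d₂) * (r₁ * e.im + q₁ * d₂)) -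
          (e.re * (r₁ * e.re + q₁ * d₁) + e.im * (r₁ * e.im + q₁ * d₂)) =
          a₁ * q₁ ^ 2 * (d₁ ^ 2 + d₂ ^ 2 - R ^ 2) := by
        linear_combination (a₁ * r₁ ^ 2 - r₁) * he +
          (q₁ * (e.re * d₁ + e.im * d₂) + r₁) * e₁ + a₁ * (q₁ * R + r₁) * E₁
      have h' : a₁ * q₁ ^ 2 * (d₁ ^ 2 + d₂ ^ 2 - R ^ 2) < 0 :=
        mul_neg_of_pos_of_neg (by positivity) (by linarith)
      simp only
      linarith
    · rw [Complex.normSq_apply]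
      simp only [Complex.sub_re, Complex.sub_im]
      have x₁ : r₁ * e.re + q₁ * d₁ - k.re = -(r₀ * e.re + q₀ * d₁) := by
        rw [hd₁]
        linear_combination (k.re - R * e.re) * hq + e.re * hR
      have x₂ : r₁ * e.im + q₁ * d₂ - k.im = -(r₀ * e.im + q₀ * d₂) := by
        rw [hd₂]
        linear_combination (k.im - R * e.im) * hq + e.im * hR
      rw [x₁, x₂]
      have : a₀ * ((r₀ * e.re + q₀ * d₁) * (r₀ * e.re + q₀ * d₁) +
          (r₀ * e.im + q₀ * d₂) * (r₀ * e.im + q₀ * d₂)) -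
          (e.re * (r₀ * e.re + q₀ * d₁) + e.im * (r₀ * e.im + q₀ * d₂)) =
          a₀ * q₀ ^ 2 * (d₁ ^ 2 + d₂ ^ 2 - R ^ 2) := by
        linear_combination (a₀ * r₀ ^ 2 - r₀) * he +
          (q₀ * (e.re * d₁ + e.im * d₂) + r₀) * e₀ + a₀ * (q₀ * R + r₀) * E₀
      have h' : a₀ * q₀ ^ 2 * (d₁ ^ 2 + d₂ ^ 2 - R ^ 2) < 0 :=
        mul_neg_of_pos_of_neg (by positivity) (by linarith)
      linarith
  have hh : 0 < e.re := by linarith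
  apply four_le_norm_add_abs_im he ?_ hW0
  · have h3 : 4 ≤ (1 / a₀ + 1 / a₁) * e.re := by
      -- Arithmetic–harmonic mean inequality.
      have h4 : 4 ≤ (1 / a₀ + 1 / a₁) * (a₀ + a₁) := by
        have : (1 / a₀ + 1 / a₁) * (a₀ + a₁) - 4 = (a₀ - a₁) ^ 2 / (a₀ * a₁) := by
          field_simp; ring
        have : 0 ≤ (a₀ - a₁) ^ 2 / (a₀ * a₁) := by positivity
        linarith
      have : (1 / a₀ + 1 / a₁) * (a₀ + a₁) ≤ (1 / a₀ + 1 / a₁) * e.re :=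
        mul_le_mul_of_nonneg_left hsum (by positivity)
      linarith
    calc 4 * W ≤ (1 / a₀ + 1 / a₁) * e.re * W := mul_le_mul_of_nonneg_right h3 hW0.le
      _ = (1 / a₀ + 1 / a₁) * W * e.re := by ring
      _ ≤ _ := mul_le_mul_of_nonneg_right hk hh.le
  · have : (a₀ + a₁) * W ≤ e.re * W := mul_le_mul_of_nonneg_right hsum hW0.le
    linarith

theorem Moebius.isParabolic_unitParabolic : Moebius.unitParabolic.IsParabolic := by
  refine ⟨_, rfl, ?_, ?_⟩
  · rintro ⟨r, hr⟩
    have := congrFun (congrFun hr 1) 0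
    simp [Moebius.matrixOf] at this
  · simp [Moebius.matrixOf, Matrix.discr_fin_two, Matrix.trace_fin_two, Matrix.det_fin_two]
    norm_num

end

section

open Matrix OrientedCircle

theorem Complex.re_mul_inv_add (e u : ℂ) :
    e.re * u⁻¹.re + e.im * u⁻¹.im = (e.re * u.re - e.im * u.im) * (Complex.normSq u)⁻¹ := by
  rw [Complex.inv_re, Complex.inv_im]
  ring

theorem mul_neg_iff_neg_of_pos {a b : ℝ} (ha : 0 < a) : a * b < 0 ↔ b < 0 := by
  rw [← neg_pos, ← mul_neg, mul_pos_iff_of_pos_left ha, neg_pos]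

/-- Write `a = transl k` and `b a = unitParabolic`. The fixed point `∞` of `a` lies on `A`, the
fixed point `0` of `b a` on `A` and `B'`, and the fixed point `k` of `a b` on `A'` and `B`. So `A`
is a line through `0`; `B'` and the translate `B₀` of `B` by `-k` touch it at `0` from opposite
sides, and `four_le_of_discs` applies with `e` the unit normal. -/
theorem four_le_of_isSchottkyPair_transl {k : ℂ} (hk : k ≠ 0)
    (H : IsSchottkyPair (Moebius.transl k) (Moebius.unitParabolic * (Moebius.transl k)⁻¹)) :
    4 ≤ ‖k‖ + |k.im| := by
  rw [isSchottkyPair_iff] at H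
  obtain ⟨A, A', B, B', hAA', hAB, hAB', hA'B, hA'B', hBB', hS, hT⟩ := H
  have hS' : ∀ z ∈ A.exterior, Moebius.transl k • z ∈ A'.interior := fun z hz =>
    hS ▸ Set.mem_image_of_mem (fun z => Moebius.transl k • z) hz
  have hT' : ∀ z ∈ B.exterior,
      Moebius.unitParabolic • (Moebius.transl k)⁻¹ • z ∈ B'.interior := fun z hz => by
    rw [← hT, ← mul_smul]
    exact Set.mem_image_of_mem (fun z => (Moebius.unitParabolic * (Moebius.transl k)⁻¹) • z) hz
  have hU0 : Moebius.unitParabolic • ((0 : ℂ) : OnePoint ℂ) = ((0 : ℂ) : OnePoint ℂ) := by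
    rw [Moebius.unitParabolic_smul_coe _ (by simp)]; simp
  have hAa : A.a = 0 := (form_fixedPoint_eq_zero (Moebius.isParabolic_transl hk)
    (Moebius.transl_smul_infty k) hAA'.symm hS').2
  obtain ⟨hB'c, hAc⟩ := form_fixedPoint_eq_zero Moebius.isParabolic_unitParabolic hU0 hAB'.symm
    (fun z hz => by
      have := hT' _ (interior_subset_exterior hA'B (hS' z hz))
      rwa [inv_smul_smul] at this)
  obtain ⟨-, hB0c⟩ := form_fixedPoint_eq_zero (p := Moebius.transl k • ((0 : ℂ) : OnePoint ℂ))
    (Moebius.isParabolic_unitParabolic.conj (Moebius.transl k))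
    (by rw [mul_smul, inv_smul_smul, mul_smul, hU0]) hA'B
    (fun z hz => by
      rw [mul_smul, mul_smul]
      exact hS' _ (interior_subset_exterior hAB'.symm (hT' _ hz)))
  rw [← form_comap_eq_zero] at hB0c
  have hB0 : ∀ z : OnePoint ℂ, z ∈ (B.comap (Moebius.transl k)).interior ↔
      Moebius.transl k • z ∈ B.interior := fun z => mem_interior_comap
  have hB0' : ∀ z : OnePoint ℂ, z ∈ (B.comap (Moebius.transl k)).exterior ↔
      Moebius.transl k • z ∈ B.exterior := fun z => mem_exterior_comap
  generalize B.comap (Moebius.transl k) = B₀ at *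
  simp only [form_coe_re_im, Complex.zero_re, Complex.zero_im, mul_zero, add_zero, zero_add]
    at hB'c hAc hB0c
  have hdisj : Disjoint A.flip.interior B₀.interior := by
    rw [interior_flip, Set.disjoint_left]
    intro z hz hz'
    exact Set.disjoint_left.1 hA'B (hS' z hz) ((hB0 z).1 hz')
  obtain ⟨σ₁, hσ₁, hb₁⟩ := exists_b_eq_neg_mul hAc hB'c hAB'
  obtain ⟨σ₀, hσ₀, hb₀⟩ := exists_b_eq_neg_mul (by simp [OrientedCircle.flip, hAc]) hB0c hdisj
  replace hb₀ : B₀.b = (σ₀ : ℂ) * A.b := by rw [hb₀]; simp [OrientedCircle.flip]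
  have hρ : 0 < ‖A.b‖ := norm_pos_iff.2 (Complex.normSq_pos.1 (normSq_b_pos hAa))
  obtain ⟨e, heA⟩ : ∃ e : ℂ, A.b = (‖A.b‖ : ℂ) * e :=
    ⟨A.b / ‖A.b‖, by rw [mul_div_cancel₀]; exact_mod_cast hρ.ne'⟩
  have he : e.re * e.re + e.im * e.im = 1 := by
    have h1 : ‖A.b‖ = ‖A.b‖ * ‖e‖ := by
      conv_lhs => rw [heA]
      simp
    have h2 : ‖e‖ = 1 := by
      have : ‖A.b‖ * (‖e‖ - 1) = 0 := by linarith
      rcases mul_eq_zero.1 this with h | h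
      · exact absurd h hρ.ne'
      · linarith
    rw [← Complex.normSq_apply, Complex.normSq_eq_norm_sq, h2, one_pow]
  rw [heA] at hb₀ hb₁
  generalize ‖A.b‖ = ρ at *
  have hA : ∀ z : ℂ, A.form z = 2 * ρ * (e.re * z.re + e.im * z.im) := by
    intro z
    rw [form_coe_re_im, hAa, hAc, heA]
    simp
    ring
  have hB' : ∀ z : ℂ, B'.form z = 2 * σ₁ * ρ *
      (B'.a / (2 * σ₁ * ρ) * Complex.normSq z - (e.re * z.re + e.im * z.im)) := by
    intro z
    rw [form_coe_re_im, hB'c, hb₁, Complex.normSq_apply]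
    simp
    field_simp
    ring
  have hB₀ : ∀ z : ℂ, B₀.form z = 2 * σ₀ * ρ *
      (B₀.a / (2 * σ₀ * ρ) * Complex.normSq z + (e.re * z.re + e.im * z.im)) := by
    intro z
    rw [form_coe_re_im, hB0c, hb₀, Complex.normSq_apply]
    simp
    field_simp
  have hmA : ∀ z : ℂ, (z : OnePoint ℂ) ∈ A.interior ↔ e.re * z.re + e.im * z.im < 0 := by
    intro z
    rw [OrientedCircle.mem_interior, hA, mul_neg_iff_neg_of_pos (by positivity)]
  have hmA' : ∀ z : ℂ, e.re * k.re + e.im * k.im < e.re * z.re + e.im * z.im →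
      (z : OnePoint ℂ) ∈ A'.interior := by
    intro z hz
    have := hS' ((z - k : ℂ) : OnePoint ℂ) (by
      rw [mem_exterior, hA]
      have : 0 < e.re * (z - k).re + e.im * (z - k).im := by
        simp only [Complex.sub_re, Complex.sub_im]; linarith
      positivity)
    rwa [Moebius.transl_smul_coe, sub_add_cancel] at this
  have hmB' : ∀ z : ℂ, (z : OnePoint ℂ) ∈ B'.interior ↔
      B'.a / (2 * σ₁ * ρ) * Complex.normSq z < e.re * z.re + e.im * z.im := by
    intro z
    rw [OrientedCircle.mem_interior, hB', mul_neg_iff_neg_of_pos (by positivity), sub_neg]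
  have hmB₀ : ∀ z : ℂ, (z : OnePoint ℂ) ∈ B₀.interior ↔
      B₀.a / (2 * σ₀ * ρ) * Complex.normSq z + (e.re * z.re + e.im * z.im) < 0 := by
    intro z
    rw [OrientedCircle.mem_interior, hB₀, mul_neg_iff_neg_of_pos (by positivity)]
  have hmB₀' : ∀ z : ℂ, (z : OnePoint ℂ) ∈ B₀.exterior ↔
      0 < B₀.a / (2 * σ₀ * ρ) * Complex.normSq z + (e.re * z.re + e.im * z.im) := by
    intro z
    rw [mem_exterior, hB₀, mul_pos_iff_of_pos_left (by positivity)]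
  generalize B'.a / (2 * σ₁ * ρ) = a₁ at *
  generalize B₀.a / (2 * σ₀ * ρ) = a₀ at *
  have hsmul : ∀ t : ℝ, e.re * (t * e).re + e.im * (t * e).im = t := by
    intro t
    simp only [Complex.re_ofReal_mul, Complex.im_ofReal_mul]
    linear_combination t * he
  have hnsq : ∀ t : ℝ, Complex.normSq (t * e) = t * t := by
    intro t
    rw [Complex.normSq_apply]
    simp only [Complex.re_ofReal_mul, Complex.im_ofReal_mul]
    linear_combination t * t * he
  have hW : 0 ≤ e.re * k.re + e.im * k.im := by
    by_contra! hneg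
    set W := e.re * k.re + e.im * k.im
    refine Set.Nonempty.not_disjoint ⟨(((W / 2 : ℝ) * e : ℂ) : OnePoint ℂ), ?_, ?_⟩ hAA'
    · rw [hmA, hsmul]; linarith
    · apply hmA'; rw [hsmul]; linarith
  apply four_le_of_discs he hW (a₀ := a₀) (a₁ := a₁)
  · apply one_le_mul_of_forall hW
    intro t ht hat
    by_contra! hlt
    refine Set.Nonempty.not_disjoint
      ⟨Moebius.transl k • (((-t : ℝ) * e : ℂ) : OnePoint ℂ), ?_, ?_⟩ hAB
    · rw [Moebius.transl_smul_coe, hmA, Complex.add_re, Complex.add_im]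
      have := hsmul (-t)
      linarith
    · rw [← hB0, hmB₀, hsmul, hnsq]
      nlinarith
  · apply one_le_mul_of_forall hW
    intro t ht hat
    by_contra! hlt
    refine Set.Nonempty.not_disjoint ⟨((t * e : ℂ) : OnePoint ℂ), ?_, ?_⟩ hA'B'
    · apply hmA'; rwa [hsmul]
    · rw [hmB', hsmul, hnsq]
      nlinarith
  -- In the coordinate `u = 1 / z` the discs are bounded by `Re (e u) = -a₀` and `Re (e u) = a₁`,
  -- and `unitParabolic` is `u ↦ u + 1`. The test point is `u = v - 1` with `Re (e v) = r`; the
  -- imaginary part `2` in `v` only keeps `v` away from `0` and `1`.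
  · by_contra! hlt
    obtain ⟨r, hr₀, hr₁⟩ := exists_between (show e.re - a₀ < a₁ by linarith)
    set v : ℂ := starRingEnd ℂ e * ⟨r, 2⟩ with hv
    have hvn : Complex.normSq v = r * r + 4 := by
      rw [hv, map_mul, Complex.normSq_conj, Complex.normSq_apply e, he, Complex.normSq_apply]
      norm_num
    have hv0 : v ≠ 0 := by
      intro h; rw [h, map_zero] at hvn; nlinarith
    have hv1 : v - 1 ≠ 0 := by
      intro h; rw [sub_eq_zero.1 h, map_one] at hvn; nlinarith
    have hev : e.re * v.re - e.im * v.im = r := by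
      rw [hv]
      simp only [Complex.mul_re, Complex.mul_im, Complex.conj_re, Complex.conj_im]
      linear_combination r * he
    have hin : (((v - 1)⁻¹ : ℂ) : OnePoint ℂ) ∈ B₀.exterior := by
      rw [hmB₀', Complex.re_mul_inv_add, map_inv₀, ← add_mul]
      apply mul_pos
      · simp only [Complex.sub_re, Complex.sub_im, Complex.one_re, Complex.one_im]
        linarith
      · exact inv_pos.2 (Complex.normSq_pos.2 hv1)
    have := hT' _ ((hB0' _).1 hin)
    have hne : (v - 1)⁻¹ + 1 = v * (v - 1)⁻¹ := by field_simp; ring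
    rw [inv_smul_smul, Moebius.unitParabolic_smul_coe _ (by
      rw [hne]; exact mul_ne_zero hv0 (inv_ne_zero hv1)), hne,
      show (v - 1)⁻¹ / (v * (v - 1)⁻¹) = v⁻¹ by field_simp, hmB', Complex.re_mul_inv_add,
      map_inv₀, hev] at this
    have := (mul_lt_mul_iff_left₀ (inv_pos.2 (Complex.normSq_pos.2 hv0))).1 this
    linarith
  · intro z hz hz'
    refine Set.Nonempty.not_disjoint ⟨(z : OnePoint ℂ), ?_, (hmB' z).2 hz⟩ hBB'
    have := (hB0 _).1 ((hmB₀ (z - k)).2 hz')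
    rwa [Moebius.transl_smul_coe, sub_add_cancel] at this

/-! ### Replacing `b` by `b aⁿ` in a Schottky pair. -/

theorem isSchottkyPair_mul_one {a b : Moebius} (H : IsSchottkyPair a b) (ha : a.IsParabolic)
    (hT : (b * a).IsParabolic) (hfix : ∀ z : OnePoint ℂ, ¬ (a • z = z ∧ (b * a) • z = z)) :
    IsSchottkyPair a (b * a) := by
  obtain ⟨h, k, e1, e2⟩ := ha.exists_normal_form hT hfix
  have hk : k ≠ 0 := by
    rintro rfl
    have h1 : Moebius.transl 0 = 1 := Moebius.ofEntries_one
    obtain ⟨p, hp⟩ := hT.exists_fixedPoint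
    exact hfix p ⟨by rw [e1, h1]; simp, hp⟩
  have H' := H.conj h
  have e3 : b = h * (Moebius.unitParabolic * (Moebius.transl k)⁻¹) * h⁻¹ := by
    rw [eq_mul_inv_of_mul_eq e2, e1]; group
  rw [e3, e1] at H'
  simp only [mul_assoc, inv_mul_cancel_left, inv_mul_cancel, mul_one] at H'
  have := (isSchottkyPair_transl_unitParabolic (four_le_of_isSchottkyPair_transl hk H')).conj h⁻¹
  rwa [inv_inv, ← e1, ← e2] at this

/-- For exponents at least `2` the conjugate `a (b aⁿ) a⁻¹ = a b aⁿ⁻¹` maps the exterior of `A` into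
the interior of `A'`, as `a` does. Both fixed points are then the touching point of `A` and `A'`,
contrary to `hfix`. -/
theorem isSchottkyPair_mul_pow {a b : Moebius} (H : IsSchottkyPair a b) (ha : a.IsParabolic)
    (n : ℕ) (hT : (b * a ^ n).IsParabolic)
    (hfix : ∀ z : OnePoint ℂ, ¬ (a • z = z ∧ (b * a ^ n) • z = z)) :
    IsSchottkyPair a (b * a ^ n) := by
  match n with
  | 0 => simpa using H
  | 1 =>
    rw [pow_one] at *
    exact isSchottkyPair_mul_one H ha hT hfix
  | n + 2 =>
    exfalso
    rw [isSchottkyPair_iff] at H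
    obtain ⟨A, A', B, B', hAA', hAB, hAB', hA'B, hA'B', hBB', hS, hT'⟩ := H
    have h1 : ∀ z ∈ A.exterior, a • z ∈ A'.interior := fun z hz =>
      hS ▸ Set.mem_image_of_mem (fun z => a • z) hz
    have h2 : ∀ z ∈ B.exterior, b • z ∈ B'.interior := fun z hz =>
      hT' ▸ Set.mem_image_of_mem (fun z => b • z) hz
    have h3 : ∀ m : ℕ, ∀ z ∈ A.exterior, a ^ (m + 1) • z ∈ A'.interior := by
      intro m
      induction m with
      | zero => simpa using h1
      | succ m ih =>
        intro z hz
        rw [pow_succ', mul_smul]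
        exact h1 _ (interior_subset_exterior hAA'.symm (ih z hz))
    obtain ⟨p, hp⟩ := ha.exists_fixedPoint
    obtain ⟨q, hq⟩ := hT.exists_fixedPoint
    obtain ⟨z1, z2⟩ := form_fixedPoint_eq_zero ha hp hAA'.symm h1
    have hq' : (a * (b * a ^ (n + 2)) * a⁻¹) • a • q = a • q := by
      rw [mul_smul, inv_smul_smul, mul_smul, hq]
    obtain ⟨z3, z4⟩ := form_fixedPoint_eq_zero (hT.conj a) hq' hAA'.symm (fun z hz => by
      have e : a * (b * a ^ (n + 2)) * a⁻¹ = a * (b * a ^ (n + 1)) := by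
        rw [pow_succ a (n + 1)]; group
      rw [e, mul_smul, mul_smul]
      exact h1 _ (interior_subset_exterior hAB'.symm
        (h2 _ (interior_subset_exterior hA'B (h3 n z hz)))))
    have := touching_point_unique hAA' hAB.symm hA'B.symm z2 z1 z4 z3
    have hpq : p = q := by
      rw [← hp] at this
      exact smul_left_cancel a this
    exact hfix p ⟨hp, hpq ▸ hq⟩

theorem isSchottkyPair_mul_zpow {a b : Moebius} (H : IsSchottkyPair a b) (ha : a.IsParabolic)
    (n : ℤ) (hT : (b * a ^ n).IsParabolic)
    (hfix : ∀ z : OnePoint ℂ, ¬ (a • z = z ∧ (b * a ^ n) • z = z)) :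
    IsSchottkyPair a (b * a ^ n) := by
  obtain ⟨n, rfl | rfl⟩ := n.eq_nat_or_neg
  · rw [zpow_natCast] at *
    exact isSchottkyPair_mul_pow H ha n hT hfix
  · have e : a ^ (-(n : ℤ)) = a⁻¹ ^ n := by simp
    rw [e] at hT hfix ⊢
    have := (isSchottkyPair_mul_pow H.inv_left ha.inv n hT (fun z hz => hfix z
      ⟨(inv_smul_eq_iff.1 hz.1).symm, hz.2⟩)).inv_left
    rwa [inv_inv] at this

end

/-! ### Complements of a basis element in the free group of rank two. -/

namespace FreeGroup

variable {α : Type*}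

/-- A word that starts and ends with letters other than `i` and has at least two letters. -/
structure IsLongBlock (i : α) (L : List (α × Bool)) : Prop where
  head_ne : ∀ x ∈ L.head?, x.1 ≠ i
  last_ne : ∀ x ∈ L.getLast?, x.1 ≠ i
  two_le : 2 ≤ L.length

theorem IsLongBlock.invRev {i : α} {L : List (α × Bool)} (h : IsLongBlock i L) :
    IsLongBlock i (invRev L) := by
  refine ⟨?_, ?_, by simpa using h.two_le⟩
  · intro x hx
    simp only [FreeGroup.invRev, List.head?_reverse, List.getLast?_map, Option.mem_def,
      Option.map_eq_some_iff] at hx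
    obtain ⟨y, hy, rfl⟩ := hx
    exact h.last_ne y hy
  · intro x hx
    simp only [FreeGroup.invRev, List.getLast?_reverse, List.head?_map, Option.mem_def,
      Option.map_eq_some_iff] at hx
    obtain ⟨y, hy, rfl⟩ := hx
    exact h.head_ne y hy

/-- With cyclic reduction `v = c k c⁻¹`, the reduced word of a positive power is `c k … k c⁻¹`,
whose first and last letters are those of `v`. -/
theorem IsLongBlock.toWord_pow_succ [DecidableEq α] {i : α} {v : FreeGroup α} (h : IsLongBlock i v.toWord)
    (n : ℕ) : IsLongBlock i (v ^ (n + 1)).toWord := by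
  have e : (v ^ (n + 1)).toWord = _ := (toWord_pow v (n + 1)).trans
    (reduceCyclically.reduce_flatten_replicate_succ isReduced_toWord n)
  have eL := reduceCyclically.conj_conjugator_reduceCyclically v.toWord
  generalize reduceCyclically.conjugator v.toWord = c at *
  generalize reduceCyclically v.toWord = k at *
  rw [← eL] at h
  have hne : c ++ k ≠ [] := by
    intro h0
    obtain ⟨rfl, rfl⟩ := List.append_eq_nil_iff.1 h0
    simpa using h.two_le
  have hne' : k ++ FreeGroup.invRev c ≠ [] := by
    intro h0
    apply hne
    obtain ⟨rfl, h1⟩ := List.append_eq_nil_iff.1 h0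
    have := congrArg List.length h1
    simp at this
    simp [this]
  rw [e]
  refine ⟨?_, ?_, ?_⟩
  · have := h.head_ne
    rw [List.head?_append_of_ne_nil _ hne] at this
    rwa [List.replicate_succ, List.flatten_cons, ← List.append_assoc, List.append_assoc,
      List.head?_append_of_ne_nil _ hne]
  · have := h.last_ne
    rw [List.append_assoc, List.getLast?_append_of_ne_nil _ hne'] at this
    rwa [List.replicate_succ', List.flatten_concat, ← List.append_assoc, List.append_assoc,
      List.getLast?_append_of_ne_nil _ hne']
  · have := h.two_le
    simp only [List.length_append, List.replicate_succ, List.flatten_cons] at this ⊢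
    omega

theorem IsLongBlock.toWord_zpow [DecidableEq α] {i : α} {v : FreeGroup α} (h : IsLongBlock i v.toWord)
    {n : ℤ} (hn : n ≠ 0) : IsLongBlock i (v ^ n).toWord := by
  obtain ⟨m, rfl | rfl⟩ := n.eq_nat_or_neg
  · obtain ⟨m, rfl⟩ := Nat.exists_eq_add_one_of_ne_zero (by simpa using hn)
    rw [zpow_natCast]
    exact h.toWord_pow_succ m
  · obtain ⟨m, rfl⟩ := Nat.exists_eq_add_one_of_ne_zero (by simpa using hn)
    rw [zpow_neg, zpow_natCast, toWord_inv]
    exact (h.toWord_pow_succ m).invRev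

theorem fst_eq_of_mem_toWord_of_zpow [DecidableEq α] {i : α} {n : ℤ} {x : α × Bool}
    (hx : x ∈ (of i ^ n).toWord) : x.1 = i := by
  obtain ⟨m, rfl | rfl⟩ := n.eq_nat_or_neg
  · rw [zpow_natCast, toWord_of_pow] at hx
    rw [List.eq_of_mem_replicate hx]
  · rw [zpow_neg, zpow_natCast, toWord_inv, toWord_of_pow] at hx
    simp only [invRev, List.map_replicate, List.reverse_replicate] at hx
    rw [List.eq_of_mem_replicate hx]

theorem toWord_of_zpow_ne_nil [DecidableEq α] (i : α) {n : ℤ} (hn : n ≠ 0) : (of i ^ n).toWord ≠ [] := by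
  obtain ⟨m, rfl | rfl⟩ := n.eq_nat_or_neg
  · simpa [zpow_natCast, toWord_of_pow] using hn
  · simpa [zpow_neg, zpow_natCast, toWord_inv, toWord_of_pow, invRev] using hn

theorem toWord_mul_of_fst_ne [DecidableEq α] {x y : FreeGroup α}
    (h : ∀ a ∈ x.toWord.getLast?, ∀ b ∈ y.toWord.head?, a.1 ≠ b.1) :
    (x * y).toWord = x.toWord ++ y.toWord := by
  rw [toWord_mul]
  apply IsReduced.reduce_eq
  exact List.isChain_append.2 ⟨isReduced_toWord, isReduced_toWord,
    fun a ha b hb e => absurd e (h a ha b hb)⟩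

/-- Alternating products of nonzero powers of `v` and `of i` that start with a power of `v`. -/
inductive IsAlternating (i : α) (v : FreeGroup α) : FreeGroup α → Prop
  | base (e m : ℤ) : e ≠ 0 → IsAlternating i v (v ^ e * of i ^ m)
  | step (e m : ℤ) (x : FreeGroup α) : e ≠ 0 → m ≠ 0 → IsAlternating i v x →
      IsAlternating i v (v ^ e * (of i ^ m * x))

theorem IsAlternating.word [DecidableEq α] {i : α} {v x : FreeGroup α} (hv : IsLongBlock i v.toWord)
    (hx : IsAlternating i v x) : (∀ a ∈ x.toWord.head?, a.1 ≠ i) ∧ 2 ≤ x.toWord.length := by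
  induction hx with
  | base e m he =>
    have h := hv.toWord_zpow he
    rw [toWord_mul_of_fst_ne (fun a ha b hb => by
      rw [fst_eq_of_mem_toWord_of_zpow (List.mem_of_mem_head? hb)]
      exact h.last_ne a ha)]
    have hne : (v ^ e).toWord ≠ [] := by
      intro h0
      simpa [h0] using h.two_le
    refine ⟨?_, ?_⟩
    · rw [List.head?_append_of_ne_nil _ hne]
      exact h.head_ne
    · rw [List.length_append]
      have := h.two_le
      omega
  | step e m x he hm _ ih =>
    have h := hv.toWord_zpow he
    have e1 : (of i ^ m * x).toWord = (of i ^ m).toWord ++ x.toWord :=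
      toWord_mul_of_fst_ne (fun a ha b hb => by
        rw [fst_eq_of_mem_toWord_of_zpow (List.mem_of_mem_getLast? ha)]
        exact (ih.1 b hb).symm)
    rw [toWord_mul_of_fst_ne (fun a ha b hb => by
      rw [e1, List.head?_append_of_ne_nil _ (toWord_of_zpow_ne_nil i hm)] at hb
      rw [fst_eq_of_mem_toWord_of_zpow (List.mem_of_mem_head? hb)]
      exact h.last_ne a ha)]
    have hne : (v ^ e).toWord ≠ [] := by
      intro h0
      simpa [h0] using h.two_le
    refine ⟨?_, ?_⟩
    · rw [List.head?_append_of_ne_nil _ hne]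
      exact h.head_ne
    · rw [List.length_append]
      have := h.two_le
      omega

/-- Adjacent powers of `v` merge; if they cancel, the next power of `of i` comes to the front. -/
theorem zpow_mul_alternating {i : α} {v g : FreeGroup α} (ε : ℤ)
    (hg : (∃ m : ℤ, g = of i ^ m) ∨ ∃ (m : ℤ) (x : _), IsAlternating i v x ∧ g = of i ^ m * x) :
    (∃ m : ℤ, v ^ ε * g = of i ^ m) ∨
      ∃ (m : ℤ) (x : _), IsAlternating i v x ∧ v ^ ε * g = of i ^ m * x := by
  by_cases hε : ε = 0
  · simpa [hε] using hg
  rcases hg with ⟨m, rfl⟩ | ⟨m, x, hx, rfl⟩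
  · exact .inr ⟨0, _, .base ε m hε, by simp⟩
  by_cases hm : m = 0
  · subst hm
    cases hx with
    | base e n he =>
      by_cases h0 : ε + e = 0
      · refine .inl ⟨n, ?_⟩
        rw [zpow_zero, one_mul, ← mul_assoc, ← zpow_add, h0, zpow_zero, one_mul]
      · refine .inr ⟨0, _, .base (ε + e) n h0, ?_⟩
        rw [zpow_zero, one_mul, one_mul, zpow_add, mul_assoc]
    | step e n y he hn hy =>
      by_cases h0 : ε + e = 0
      · refine .inr ⟨n, y, hy, ?_⟩
        rw [zpow_zero, one_mul, ← mul_assoc, ← zpow_add, h0, zpow_zero, one_mul]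
      · refine .inr ⟨0, _, .step (ε + e) n y h0 hn hy, ?_⟩
        rw [zpow_zero, one_mul, one_mul, zpow_add, mul_assoc]
  · exact .inr ⟨0, _, .step ε m x hε hm hx, by simp⟩

/-- No cancellation occurs between powers of a long block `v` and of `of i`. An element of the
subgroup that is not a power of `of i` thus has reduced length at least `2`, which excludes `of j`.
-/
theorem not_isLongBlock_of_closure_eq_top [DecidableEq α] {i j : α} (hij : i ≠ j) {v : FreeGroup α}
    (h : Subgroup.closure {of i, v} = ⊤) : ¬ IsLongBlock i v.toWord := by
  intro hv
  have key : ∀ g ∈ Subgroup.closure {of i, v}, (∃ m : ℤ, g = of i ^ m) ∨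
      ∃ (m : ℤ) (x : _), IsAlternating i v x ∧ g = of i ^ m * x := by
    intro g hg
    have hi : ∀ (ε : ℤ) (y : FreeGroup α), ((∃ m : ℤ, y = of i ^ m) ∨
        ∃ (m : ℤ) (x : _), IsAlternating i v x ∧ y = of i ^ m * x) →
        ((∃ m : ℤ, of i ^ ε * y = of i ^ m) ∨
          ∃ (m : ℤ) (x : _), IsAlternating i v x ∧ of i ^ ε * y = of i ^ m * x) := by
      rintro ε y (⟨m, rfl⟩ | ⟨m, x, hx, rfl⟩)
      · exact .inl ⟨ε + m, (zpow_add _ _ _).symm⟩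
      · exact .inr ⟨ε + m, x, hx, by rw [zpow_add, mul_assoc]⟩
    induction hg using Subgroup.closure_induction_left with
    | one => exact .inl ⟨0, by simp⟩
    | mul_left x hx y _ ih =>
      rcases hx with rfl | rfl
      · simpa using hi 1 y ih
      · simpa using zpow_mul_alternating 1 ih
    | inv_mul_cancel x hx y _ ih =>
      rcases hx with rfl | rfl
      · simpa using hi (-1) y ih
      · simpa using zpow_mul_alternating (-1) ih
  rcases key (of j) (h ▸ Subgroup.mem_top _) with ⟨m, hm⟩ | ⟨m, x, hx, e⟩
  · have : (j, true) ∈ (of i ^ m).toWord := by rw [← hm, toWord_of]; simp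
    exact hij (fst_eq_of_mem_toWord_of_zpow this).symm
  · obtain ⟨h1, h2⟩ := hx.word hv
    have h3 := congrArg (fun g => (toWord g).length) e
    simp only [toWord_of] at h3
    rw [toWord_mul_of_fst_ne (fun a ha b hb => by
        rw [fst_eq_of_mem_toWord_of_zpow (List.mem_of_mem_getLast? ha)]
        exact (h1 b hb).symm), List.length_append, List.length_singleton] at h3
    omega

theorem mk_singleton_eq (x : α × Bool) : mk [x] = of x.1 ∨ mk [x] = (of x.1)⁻¹ := by
  obtain ⟨i, _ | _⟩ := x
  · exact .inr rfl
  · exact .inl rfl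

theorem exists_mul_zpow_eq [DecidableEq α] (i : α) (w : FreeGroup α) :
    ∃ (m n : ℤ) (v : FreeGroup α), w = of i ^ m * v * of i ^ n ∧
      (∀ x ∈ v.toWord.head?, x.1 ≠ i) ∧ ∀ x ∈ v.toWord.getLast?, x.1 ≠ i := by
  induction hN : w.norm using Nat.strong_induction_on generalizing w with
  | _ N ih =>
  have hz : ∀ x : α × Bool, x.1 = i → ∃ ε : ℤ, mk [x] = of i ^ ε := by
    rintro x rfl
    rcases mk_singleton_eq x with h | h
    · exact ⟨1, by simpa using h⟩
    · exact ⟨-1, by simpa using h⟩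
  by_cases h1 : ∀ x ∈ w.toWord.head?, x.1 ≠ i
  · by_cases h2 : ∀ x ∈ w.toWord.getLast?, x.1 ≠ i
    · exact ⟨0, 0, w, by simp, h1, h2⟩
    · push Not at h2
      obtain ⟨x, hx, hi⟩ := h2
      obtain ⟨L, hL⟩ := List.mem_getLast?_eq_getLast hx |> fun ⟨hne, e⟩ =>
        (⟨_, by rw [e]; exact (List.dropLast_append_getLast hne).symm⟩ : ∃ L, w.toWord = L ++ [x])
      have hw : w = mk L * mk [x] := by rw [mul_mk, ← hL, mk_toWord]
      obtain ⟨ε, hε⟩ := hz x hi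
      obtain ⟨m, n, v, e, h3, h4⟩ := ih (mk L).norm (by
        have h5 : w.norm = L.length + 1 := by rw [norm, hL]; simp
        have := norm_mk_le (L₁ := L)
        omega) (mk L) rfl
      exact ⟨m, n + ε, v, by rw [hw, hε, e, zpow_add, mul_assoc], h3, h4⟩
  · push Not at h1
    obtain ⟨x, hx, hi⟩ := h1
    obtain ⟨L, hL⟩ : ∃ L, w.toWord = x :: L := List.head?_eq_some_iff.1 hx
    have hw : w = mk [x] * mk L := by
      rw [mul_mk, List.singleton_append, ← hL, mk_toWord]
    obtain ⟨ε, hε⟩ := hz x hi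
    obtain ⟨m, n, v, e, h3, h4⟩ := ih (mk L).norm (by
      have h5 : w.norm = L.length + 1 := by rw [norm, hL]; simp
      have := norm_mk_le (L₁ := L)
      omega) (mk L) rfl
    exact ⟨ε + m, n, v, by rw [hw, hε, e, zpow_add]; simp only [mul_assoc], h3, h4⟩

/-- The elements that complete `of i` to a generating pair of a free group of rank two. -/
theorem exists_eq_of_closure_eq_top {i j : Fin 2} (hij : i ≠ j) {w : FreeGroup (Fin 2)}
    (h : Subgroup.closure {of i, w} = ⊤) :
    ∃ m n : ℤ, w = of i ^ m * of j * of i ^ n ∨ w = of i ^ m * (of j)⁻¹ * of i ^ n := by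
  obtain ⟨m, n, v, rfl, h1, h2⟩ := exists_mul_zpow_eq i w
  refine ⟨m, n, ?_⟩
  have hv : Subgroup.closure {of i, v} = ⊤ := by
    rw [eq_top_iff, ← h, Subgroup.closure_le]
    have hi : of i ∈ Subgroup.closure {of i, v} := Subgroup.subset_closure (by simp)
    rintro x (rfl | rfl)
    · exact hi
    · exact mul_mem (mul_mem (zpow_mem hi m) (Subgroup.subset_closure (by simp))) (zpow_mem hi n)
  have hlen : v.toWord.length < 2 := by
    by_contra! hge
    exact not_isLongBlock_of_closure_eq_top hij hv ⟨h1, h2, hge⟩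
  match hL : v.toWord with
  | [] =>
    exfalso
    rw [toWord_eq_nil_iff] at hL
    have : (of j) ∈ Subgroup.closure {of i, v} := hv ▸ Subgroup.mem_top _
    -- The exponent sum of `j` vanishes on this subgroup but not on `of j`.
    have hle : Subgroup.closure {of i, v} ≤ (FreeGroup.lift fun k : Fin 2 =>
        if k = j then Multiplicative.ofAdd (1 : ℤ) else 1).ker := by
      rw [Subgroup.closure_le]
      rintro x (rfl | rfl)
      · simp [MonoidHom.mem_ker, hij]
      · simp [hL]
    have := hle this
    simp [MonoidHom.mem_ker] at this
  | [x] =>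
    have hvx : v = mk [x] := by rw [← hL, mk_toWord]
    have hx : x.1 = j := by
      have : x.1 ≠ i := h1 x (by simp [hL])
      omega
    rw [hvx, ← hx]
    rcases mk_singleton_eq x with e | e <;> rw [e] <;> simp
  | x :: y :: L => simp [hL] at hlen

end FreeGroup

/-! ### Exponent sums, commutation and rank. -/

/-- The integral Heisenberg group. -/
@[ext] structure Heisenberg where
  x : ℤ
  y : ℤ
  z : ℤ

namespace Heisenberg

instance : Mul Heisenberg := ⟨fun a b => ⟨a.x + b.x, a.y + b.y, a.z + b.z + a.x * b.y⟩⟩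
instance : One Heisenberg := ⟨⟨0, 0, 0⟩⟩
instance : Inv Heisenberg := ⟨fun a => ⟨-a.x, -a.y, -a.z + a.x * a.y⟩⟩

@[simp] theorem mul_x (a b : Heisenberg) : (a * b).x = a.x + b.x := rfl
@[simp] theorem mul_y (a b : Heisenberg) : (a * b).y = a.y + b.y := rfl
@[simp] theorem mul_z (a b : Heisenberg) : (a * b).z = a.z + b.z + a.x * b.y := rfl
@[simp] theorem one_x : (1 : Heisenberg).x = 0 := rfl
@[simp] theorem one_y : (1 : Heisenberg).y = 0 := rfl
@[simp] theorem one_z : (1 : Heisenberg).z = 0 := rfl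
@[simp] theorem inv_x (a : Heisenberg) : (a⁻¹).x = -a.x := rfl
@[simp] theorem inv_y (a : Heisenberg) : (a⁻¹).y = -a.y := rfl
@[simp] theorem inv_z (a : Heisenberg) : (a⁻¹).z = -a.z + a.x * a.y := rfl

instance : Group Heisenberg :=
  Group.ofLeftAxioms (fun a b c => by ext <;> simp <;> ring) (fun a => by ext <;> simp)
    (fun a => by ext <;> simp)

/-- The determinant is the difference of the `z`-coordinates of `a * b` and `b * a`. -/
theorem det_eq_zero_of_commute {a b : Heisenberg} (h : Commute a b) :
    a.x * b.y - a.y * b.x = 0 := by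
  have := congrArg Heisenberg.z h.eq
  simp only [mul_z] at this
  linarith

end Heisenberg

namespace FreeGroup

/-- The map of the free group of rank two onto the Heisenberg group; its first two coordinates
are the exponent sums of the generators. -/
def toHeisenberg : FreeGroup (Fin 2) →* Heisenberg := lift ![⟨1, 0, 0⟩, ⟨0, 1, 0⟩]

/-- The determinant of the exponent sums of two elements. -/
def expDet (s t : FreeGroup (Fin 2)) : ℤ :=
  (toHeisenberg s).x * (toHeisenberg t).y - (toHeisenberg s).y * (toHeisenberg t).x

theorem expDet_conj (s t c d : FreeGroup (Fin 2)) :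
    expDet (c * s * c⁻¹) (d * t * d⁻¹) = expDet s t := by
  simp [expDet]

theorem expDet_eq_zero_of_commute {s t : FreeGroup (Fin 2)} (h : Commute s t) : expDet s t = 0 :=
  Heisenberg.det_eq_zero_of_commute (h.map toHeisenberg)

/-- The exponent vectors of a generating pair span `ℤ²`; expressing the standard basis through them
gives an inverse determinant. -/
theorem isUnit_expDet {s t : FreeGroup (Fin 2)} (h : Subgroup.closure {s, t} = ⊤) :
    IsUnit (expDet s t) := by
  have key : ∀ g ∈ Subgroup.closure {s, t}, ∃ a b : ℤ,
      (toHeisenberg g).x = a * (toHeisenberg s).x + b * (toHeisenberg t).x ∧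
      (toHeisenberg g).y = a * (toHeisenberg s).y + b * (toHeisenberg t).y := by
    intro g hg
    induction hg using Subgroup.closure_induction with
    | mem x hx =>
      rcases hx with rfl | rfl
      · exact ⟨1, 0, by simp⟩
      · exact ⟨0, 1, by simp⟩
    | one => exact ⟨0, 0, by simp⟩
    | mul x y _ _ hx hy =>
      obtain ⟨a, b, h1, h2⟩ := hx
      obtain ⟨c, d, h3, h4⟩ := hy
      exact ⟨a + c, b + d, by simp [h1, h3]; ring, by simp [h2, h4]; ring⟩
    | inv x _ hx =>
      obtain ⟨a, b, h1, h2⟩ := hx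
      exact ⟨-a, -b, by simp [h1]; ring, by simp [h2]; ring⟩
  obtain ⟨a, b, h1, h2⟩ := key (of 0) (h ▸ Subgroup.mem_top _)
  obtain ⟨c, d, h3, h4⟩ := key (of 1) (h ▸ Subgroup.mem_top _)
  simp [toHeisenberg] at h1 h2 h3 h4
  apply IsUnit.of_mul_eq_one (a * d - b * c)
  change _ * _ = (1 : ℤ)
  rw [expDet, toHeisenberg]
  generalize (lift ![(⟨1, 0, 0⟩ : Heisenberg), ⟨0, 1, 0⟩]) s = S at *
  generalize (lift ![(⟨1, 0, 0⟩ : Heisenberg), ⟨0, 1, 0⟩]) t = T at *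
  linear_combination (-(c * S.y + d * T.y)) * h1 - h4 + (c * S.x + d * T.x) * h2

/-- A free group of rank `n` that is generated by two elements has `n ≤ 2`. -/
theorem le_two_of_closure_eq_top {n : ℕ} {s t : FreeGroup (Fin n)}
    (h : Subgroup.closure {s, t} = ⊤) : n ≤ 2 := by
  classical
  set f : FreeGroup (Fin n) →* Multiplicative (Fin n → ℚ) :=
    lift fun i => Multiplicative.ofAdd (Pi.single i 1) with hf
  have key : ∀ g ∈ Subgroup.closure {s, t},
      (f g).toAdd ∈ Submodule.span ℚ ({(f s).toAdd, (f t).toAdd} : Set (Fin n → ℚ)) := by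
    intro g hg
    induction hg using Subgroup.closure_induction with
    | mem x hx =>
      apply Submodule.subset_span
      rcases hx with rfl | rfl <;> simp
    | one => simp
    | mul x y _ _ hx hy =>
      rw [MonoidHom.map_mul, toAdd_mul]
      exact add_mem hx hy
    | inv x _ hx =>
      rw [MonoidHom.map_inv, toAdd_inv]
      exact neg_mem hx
  have htop : Submodule.span ℚ ({(f s).toAdd, (f t).toAdd} : Set (Fin n → ℚ)) = ⊤ := by
    rw [eq_top_iff, ← (Pi.basisFun ℚ (Fin n)).span_eq, Submodule.span_le]
    rintro _ ⟨i, rfl⟩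
    have := key (of i) (h ▸ Subgroup.mem_top _)
    simpa [hf] using this
  have h1 := finrank_span_finset_le_card (R := ℚ) ({(f s).toAdd, (f t).toAdd} : Finset (Fin n → ℚ))
  rw [Set.finrank, Finset.coe_insert, Finset.coe_singleton, htop, finrank_top,
    Module.finrank_fin_fun] at h1
  exact h1.trans Finset.card_le_two

/-! ### Periodic words and their turns. -/

/-- The inverse of a letter. -/
def letterInv {α : Type*} (x : α × Bool) : α × Bool := (x.1, !x.2)

/-- The product of the `n` consecutive letters of the sequence `x` from the `i`-th on. -/
def seqProd {α : Type*} (x : ℕ → α × Bool) (i : ℕ) : ℕ → FreeGroup α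
  | 0 => 1
  | n + 1 => mk [x i] * seqProd x (i + 1) n

theorem seqProd_succ_right {α : Type*} (x : ℕ → α × Bool) (i n : ℕ) :
    seqProd x i (n + 1) = seqProd x i n * mk [x (i + n)] := by
  induction n generalizing i with
  | zero => simp [seqProd]
  | succ n ih =>
    rw [seqProd, ih, seqProd, mul_assoc, show i + 1 + n = i + (n + 1) by ring]

/-- `x` is an infinite periodic reduced word of period `k`. -/
structure IsPeriodicWord {α : Type*} (x : ℕ → α × Bool) (k : ℕ) : Prop where
  pos : 0 < k
  periodic : ∀ i, x (i + k) = x i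
  reduced : ∀ i, x (i + 1) ≠ letterInv (x i)

theorem IsPeriodicWord.seqProd_conj {α : Type*} {x : ℕ → α × Bool} {k : ℕ}
    (h : IsPeriodicWord x k) (i : ℕ) :
    ∃ c, seqProd x i k = c * seqProd x 0 k * c⁻¹ := by
  induction i with
  | zero => exact ⟨1, by simp⟩
  | succ i ih =>
    obtain ⟨c, hc⟩ := ih
    have e : FreeGroup.mk [x i] * seqProd x (i + 1) k = seqProd x i k * FreeGroup.mk [x i] := by
      have := seqProd_succ_right x i k
      rwa [seqProd, h.periodic] at this
    refine ⟨(FreeGroup.mk [x i])⁻¹ * c, ?_⟩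
    rw [eq_inv_mul_of_mul_eq e, hc]
    group

theorem exists_isPeriodicWord {α : Type*} [DecidableEq α] {s : FreeGroup α} (hs : s ≠ 1) :
    ∃ (x : ℕ → α × Bool) (k : ℕ) (c : FreeGroup α), IsPeriodicWord x k ∧
      s = c * seqProd x 0 k * c⁻¹ := by
  have hcr := reduceCyclically.isCyclicallyReduced (isReduced_toWord (x := s))
  have eL := reduceCyclically.conj_conjugator_reduceCyclically s.toWord
  generalize reduceCyclically.conjugator s.toWord = c at *
  generalize reduceCyclically s.toWord = L at *
  have hs' : s = mk c * mk L * (mk c)⁻¹ := by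
    rw [inv_mk, mul_mk, mul_mk, eL, mk_toWord]
  have hL : L ≠ [] := by
    rintro rfl
    apply hs
    rw [hs', ← one_eq_mk, mul_one, mul_inv_cancel]
  have hpos : 0 < L.length := List.length_pos_iff.2 hL
  have hlt : ∀ i, i % L.length < L.length := fun i => Nat.mod_lt _ hpos
  refine ⟨fun i => L[i % L.length]'(hlt i), L.length, mk c, ⟨hpos, fun i => by simp, ?_⟩, ?_⟩
  · intro i hi
    have key : (L[i % L.length]'(hlt i)).1 = (L[(i + 1) % L.length]'(hlt _)).1 →
        (L[i % L.length]'(hlt i)).2 = (L[(i + 1) % L.length]'(hlt _)).2 := by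
      rcases Nat.lt_or_ge (i % L.length + 1) L.length with h | h
      · have h2 := List.isChain_iff_getElem.1 hcr.isReduced (i % L.length) h
        have e : (i + 1) % L.length = i % L.length + 1 := by
          rw [Nat.add_mod, Nat.mod_eq_of_lt (a := 1) (by omega), Nat.mod_eq_of_lt h]
        simpa only [e] using h2
      -- At the wrap-around, cyclic reducedness compares the last letter with the first.
      · have e1 : i % L.length = L.length - 1 := by have := hlt i; omega
        have e2 : (i + 1) % L.length = 0 := by
          rw [← Nat.mod_add_mod, e1, Nat.sub_add_cancel hpos, Nat.mod_self]
        have h2 := hcr.2 (L[L.length - 1]) (by simp [List.getLast?_eq_getElem?]) (L[0])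
          (by simp [List.head?_eq_getElem?])
        simpa only [e1, e2] using h2
    simp only [hi, letterInv] at key
    simp at key
  · rw [hs']
    congr 2
    have : ∀ n j, j + n = L.length →
        mk (L.drop j) = seqProd (fun i => L[i % L.length]'(hlt i)) j n := by
      intro n
      induction n with
      | zero =>
        intro j hj
        rw [List.drop_eq_nil_of_le (by omega)]
        rfl
      | succ n ih =>
        intro j hj
        rw [seqProd, ← ih (j + 1) (by omega), mul_mk, List.drop_eq_getElem_cons (by omega)]
        simp [Nat.mod_eq_of_lt (show j < L.length by omega)]
    simpa using this L.length 0 (by simp)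

end FreeGroup

namespace FreeGroup

/-- The periodic word `x` contains `u⁻¹ v` or `v⁻¹ u`. -/
def Passes {α : Type*} (x : ℕ → α × Bool) (u v : α × Bool) : Prop :=
  ∃ i, (letterInv (x i) = u ∧ x (i + 1) = v) ∨ (letterInv (x i) = v ∧ x (i + 1) = u)

theorem exists_change_of_periodic {f : ℕ → Bool} {k : ℕ} (hk : 0 < k)
    (hf : ∀ i, f (i + k) = f i) (c : Bool) (h1 : ∃ i, f i = c) (h2 : ∃ j, f j = !c) :
    ∃ i, f i = c ∧ f (i + 1) = !c := by
  by_contra! hcon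
  obtain ⟨i, hi⟩ := h1
  obtain ⟨j, hj⟩ := h2
  have hall : ∀ m, f (i + m) = c := by
    intro m
    induction m with
    | zero => exact hi
    | succ m ih =>
      have := hcon _ ih
      rw [← add_assoc]
      revert this
      cases f (i + m + 1) <;> cases c <;> simp
  have hper : ∀ m, f (j + m * k) = f j := by
    intro m
    induction m with
    | zero => simp
    | succ m ih => rw [show j + (m + 1) * k = j + m * k + k by ring, hf, ih]
  -- Moving `i` periods beyond `j` gives an index at least `i`, so the natural subtraction is not
  -- truncated.
  have h3 := hall (j + i * k - i)
  have hle : i ≤ j + i * k := by nlinarith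
  rw [Nat.add_sub_cancel' hle, hper, hj] at h3
  cases c <;> simp at h3

theorem exists_rise_and_fall {f : ℕ → Bool} {k : ℕ} (hk : 0 < k) (hf : ∀ i, f (i + k) = f i)
    (hne : ∃ i j, f i ≠ f j) (c : Bool) : ∃ i, f i = c ∧ f (i + 1) = !c := by
  obtain ⟨i, j, hij⟩ := hne
  apply exists_change_of_periodic hk hf c
  · by_cases h : f i = c
    · exact ⟨i, h⟩
    · refine ⟨j, ?_⟩
      revert h hij
      cases f i <;> cases f j <;> cases c <;> simp
  · by_cases h : f i = !c
    · exact ⟨i, h⟩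
    · refine ⟨j, ?_⟩
      revert h hij
      cases f i <;> cases f j <;> cases c <;> simp

/-- The sign of a letter, twisted by its index. -/
def twistedSign (p : Fin 2 × Bool) : Bool := xor (decide (p.1 = 1)) p.2

/-- Where the sign rises, reducedness makes the indices differ, so the word reads `a⁻¹ b` or `b⁻¹
a`. -/
theorem passes_of_sign {x : ℕ → Fin 2 × Bool} {k : ℕ} (hx : IsPeriodicWord x k)
    (h : ∃ i j, (x i).2 ≠ (x j).2) : Passes x (0, true) (1, true) := by
  obtain ⟨i, h1, h2⟩ := exists_rise_and_fall (f := fun i => (x i).2) hx.pos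
    (fun i => by simp only [hx.periodic]) h false
  have h3 := hx.reduced i
  refine ⟨i, ?_⟩
  simp only [letterInv] at h1 h2 h3 ⊢
  generalize x i = a at *
  generalize x (i + 1) = b at *
  obtain ⟨p, s⟩ := a
  obtain ⟨q, t⟩ := b
  clear hx h
  fin_cases p <;> fin_cases q <;> cases s <;> cases t <;> simp_all

/-- The argument of `passes_of_sign` after exchanging the second generator with its inverse. -/
theorem passes_of_twistedSign {x : ℕ → Fin 2 × Bool} {k : ℕ} (hx : IsPeriodicWord x k)
    (h : ∃ i j, twistedSign (x i) ≠ twistedSign (x j)) : Passes x (0, true) (1, false) := by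
  obtain ⟨i, h1, h2⟩ := exists_rise_and_fall (f := fun i => twistedSign (x i)) hx.pos
    (fun i => by simp only [hx.periodic]) h false
  have h3 := hx.reduced i
  refine ⟨i, ?_⟩
  simp only [letterInv] at h1 h2 h3 ⊢
  generalize x i = a at *
  generalize x (i + 1) = b at *
  obtain ⟨p, s⟩ := a
  obtain ⟨q, t⟩ := b
  clear hx h
  fin_cases p <;> fin_cases q <;> cases s <;> cases t <;> simp_all [twistedSign]

/-- The value `±1` of a sign. -/
def signInt (b : Bool) : ℤ := if b then 1 else -1

theorem toHeisenberg_letter_x (p : Fin 2 × Bool) :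
    (toHeisenberg (mk [p])).x = if p.1 = 0 then signInt p.2 else 0 := by
  obtain ⟨i, b⟩ := p
  fin_cases i <;> cases b <;> simp [toHeisenberg, signInt]

theorem toHeisenberg_letter_y (p : Fin 2 × Bool) :
    (toHeisenberg (mk [p])).y = if p.1 = 1 then signInt p.2 else 0 := by
  obtain ⟨i, b⟩ := p
  fin_cases i <;> cases b <;> simp [toHeisenberg, signInt]

theorem exists_exponents {x : ℕ → Fin 2 × Bool} {ε : Fin 2 → ℤ}
    (h : ∀ i, signInt (x i).2 = ε (x i).1) (n i : ℕ) :
    ∃ N₀ N₁ : ℤ, 0 ≤ N₀ ∧ 0 ≤ N₁ ∧ (toHeisenberg (seqProd x i n)).x = ε 0 * N₀ ∧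
      (toHeisenberg (seqProd x i n)).y = ε 1 * N₁ ∧
      ((∃ j < n, (x (i + j)).1 = 0) → 0 < N₀) ∧ ((∃ j < n, (x (i + j)).1 = 1) → 0 < N₁) := by
  induction n generalizing i with
  | zero => exact ⟨0, 0, by simp [seqProd]⟩
  | succ n ih =>
    obtain ⟨N₀, N₁, p₀, p₁, e₀, e₁, q₀, q₁⟩ := ih (i + 1)
    have hx := toHeisenberg_letter_x (x i)
    have hy := toHeisenberg_letter_y (x i)
    have shift : ∀ p : Fin 2, (∃ j < n + 1, (x (i + j)).1 = p) → (x i).1 ≠ p →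
        ∃ j < n, (x (i + 1 + j)).1 = p := by
      rintro p ⟨j, hj, hp⟩ hne
      obtain _ | j := j
      · exact absurd hp hne
      · exact ⟨j, by omega, by rwa [show i + 1 + j = i + (j + 1) by ring]⟩
    rw [h i] at hx hy
    rcases (show (x i).1 = 0 ∨ (x i).1 = 1 by omega) with h0 | h0
    · refine ⟨N₀ + 1, N₁, by omega, p₁, ?_, ?_, fun _ => by omega, fun hj => ?_⟩
      · rw [seqProd, MonoidHom.map_mul, Heisenberg.mul_x, hx, e₀, h0]; simp; ring
      · rw [seqProd, MonoidHom.map_mul, Heisenberg.mul_y, hy, e₁, h0]; simp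
      · exact q₁ (shift 1 hj (by simp [h0]))
    · refine ⟨N₀, N₁ + 1, p₀, by omega, ?_, ?_, fun hj => ?_, fun _ => by omega⟩
      · rw [seqProd, MonoidHom.map_mul, Heisenberg.mul_x, hx, e₀, h0]; simp
      · rw [seqProd, MonoidHom.map_mul, Heisenberg.mul_y, hy, e₁, h0]; simp; ring
      · exact q₀ (shift 0 hj (by simp [h0]))

theorem exists_pos_exponents {x : ℕ → Fin 2 × Bool} {k : ℕ} (hx : IsPeriodicWord x k)
    {ε : Fin 2 → ℤ} (h : ∀ i, signInt (x i).2 = ε (x i).1) (hne : ∃ i j, (x i).1 ≠ (x j).1) :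
    ∃ N₀ N₁ : ℤ, 0 < N₀ ∧ 0 < N₁ ∧ (toHeisenberg (seqProd x 0 k)).x = ε 0 * N₀ ∧
      (toHeisenberg (seqProd x 0 k)).y = ε 1 * N₁ := by
  obtain ⟨N₀, N₁, -, -, e₀, e₁, q₀, q₁⟩ := exists_exponents h k 0
  have hmod : ∀ i, x (i % k) = x i := (show Function.Periodic x k from hx.periodic).map_mod_nat
  have hex : ∀ p : Fin 2, ∃ j < k, (x (0 + j)).1 = p := by
    intro p
    obtain ⟨i, j, hij⟩ := hne
    rcases (show (x i).1 = p ∨ (x j).1 = p by omega) with h | h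
    · exact ⟨i % k, Nat.mod_lt _ hx.pos, by rw [zero_add, hmod, h]⟩
    · exact ⟨j % k, Nat.mod_lt _ hx.pos, by rw [zero_add, hmod, h]⟩
  exact ⟨N₀, N₁, q₀ (hex 0), q₁ (hex 1), e₀, e₁⟩

/-- All letters have one sign; since the twisted sign varies, both generators occur. -/
theorem exponents_of_sign_const {x : ℕ → Fin 2 × Bool} {k : ℕ} (hx : IsPeriodicWord x k)
    (h : ¬ ∃ i j, (x i).2 ≠ (x j).2) (h' : ∃ i j, twistedSign (x i) ≠ twistedSign (x j)) :
    ∃ δ N₀ N₁ : ℤ, (δ = 1 ∨ δ = -1) ∧ 0 < N₀ ∧ 0 < N₁ ∧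
      (toHeisenberg (seqProd x 0 k)).x = δ * N₀ ∧ (toHeisenberg (seqProd x 0 k)).y = δ * N₁ := by
  push Not at h
  obtain ⟨N₀, N₁, p₀, p₁, e₀, e₁⟩ := exists_pos_exponents hx (ε := fun _ => signInt (x 0).2)
    (fun i => by rw [h i 0]) (by
      obtain ⟨i, j, hij⟩ := h'
      exact ⟨i, j, fun e => hij (by rw [twistedSign, twistedSign, e, h i j])⟩)
  exact ⟨signInt (x 0).2, N₀, N₁, by cases (x 0).2 <;> simp [signInt], p₀, p₁, e₀, e₁⟩

theorem exponents_of_twistedSign_const {x : ℕ → Fin 2 × Bool} {k : ℕ} (hx : IsPeriodicWord x k)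
    (h : ¬ ∃ i j, twistedSign (x i) ≠ twistedSign (x j)) (h' : ∃ i j, (x i).2 ≠ (x j).2) :
    ∃ δ N₀ N₁ : ℤ, (δ = 1 ∨ δ = -1) ∧ 0 < N₀ ∧ 0 < N₁ ∧
      (toHeisenberg (seqProd x 0 k)).x = δ * N₀ ∧ (toHeisenberg (seqProd x 0 k)).y = -δ * N₁ := by
  push Not at h
  set δ := signInt (twistedSign (x 0)) with hδ
  obtain ⟨N₀, N₁, p₀, p₁, e₀, e₁⟩ := exists_pos_exponents hx (ε := ![δ, -δ])
    (fun i => by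
      rw [hδ, h 0 i]
      generalize x i = a
      revert a
      decide) (by
      obtain ⟨i, j, hij⟩ := h'
      refine ⟨i, j, fun e => hij ?_⟩
      have := h i j
      simp only [twistedSign, e] at this
      simpa using this)
  exact ⟨δ, N₀, N₁, by rw [hδ]; cases twistedSign (x 0) <;> simp [signInt], p₀, p₁,
    by simpa using e₀, by simpa using e₁⟩

theorem seqProd_of_const {α : Type*} {x : ℕ → α × Bool} {p : α × Bool} (h : ∀ i, x i = p)
    (n i : ℕ) : seqProd x i n = mk [p] ^ n := by
  induction n generalizing i with
  | zero => rfl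
  | succ n ih => rw [seqProd, ih, h, pow_succ']

theorem toHeisenberg_pow (s : FreeGroup (Fin 2)) (n : ℕ) :
    (toHeisenberg (s ^ n)).x = n * (toHeisenberg s).x ∧
      (toHeisenberg (s ^ n)).y = n * (toHeisenberg s).y := by
  induction n with
  | zero => simp
  | succ n ih =>
    rw [pow_succ, MonoidHom.map_mul, Heisenberg.mul_x, Heisenberg.mul_y, ih.1, ih.2]
    constructor <;> push_cast <;> ring

theorem expDet_swap (s t : FreeGroup (Fin 2)) : expDet t s = -expDet s t := by
  rw [expDet, expDet]; ring

theorem eq_letter_of_const {x : ℕ → Fin 2 × Bool} {k : ℕ}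
    (h : ¬ ∃ i j, (x i).2 ≠ (x j).2) (h' : ¬ ∃ i j, twistedSign (x i) ≠ twistedSign (x j))
    {t : FreeGroup (Fin 2)} (hdet : IsUnit (expDet (seqProd x 0 k) t)) :
    ∃ p, seqProd x 0 k = mk [p] := by
  push Not at h h'
  have hc : ∀ i, x i = x 0 := by
    intro i
    have h1 := h i 0
    have h2 := h' i 0
    generalize x i = a at *
    generalize x 0 = b at *
    revert a b
    decide
  have e := seqProd_of_const hc k 0
  rw [e] at hdet
  have : expDet (mk [x 0] ^ k) t = k * expDet (mk [x 0]) t := by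
    rw [expDet, expDet, (toHeisenberg_pow _ k).1, (toHeisenberg_pow _ k).2]; ring
  rw [this] at hdet
  have hk : k = 1 := by
    have := isUnit_of_mul_isUnit_left hdet
    rw [Int.isUnit_iff] at this
    omega
  refine ⟨x 0, ?_⟩
  rw [e, hk, pow_one]

/-- One exponent vector has coordinates of equal sign, the other of opposite signs. The two terms of
the determinant then add up to absolute value at least `2`. -/
theorem not_isUnit_expDet {s t : FreeGroup (Fin 2)}
    (hs : ∃ δ N₀ N₁ : ℤ, (δ = 1 ∨ δ = -1) ∧ 0 < N₀ ∧ 0 < N₁ ∧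
      (toHeisenberg s).x = δ * N₀ ∧ (toHeisenberg s).y = δ * N₁)
    (ht : ∃ δ N₀ N₁ : ℤ, (δ = 1 ∨ δ = -1) ∧ 0 < N₀ ∧ 0 < N₁ ∧
      (toHeisenberg t).x = δ * N₀ ∧ (toHeisenberg t).y = -δ * N₁) : ¬ IsUnit (expDet s t) := by
  obtain ⟨δ, N₀, N₁, hδ, p₀, p₁, e₀, e₁⟩ := hs
  obtain ⟨ε, M₀, M₁, hε, q₀, q₁, f₀, f₁⟩ := ht
  rw [Int.isUnit_iff, expDet, e₀, e₁, f₀, f₁]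
  have h1 : 0 < N₀ * M₁ := mul_pos p₀ q₁
  have h2 : 0 < N₁ * M₀ := mul_pos p₁ q₀
  rcases hδ with rfl | rfl <;> rcases hε with rfl | rfl <;> rintro (h | h) <;> nlinarith

/-- Two periodic words that do not pass through a common pair of letters, and whose exponent sums
are a basis of `ℤ²`: one of them is a single letter. -/
theorem exists_eq_letter {x y : ℕ → Fin 2 × Bool} {k l : ℕ} (hx : IsPeriodicWord x k)
    (hy : IsPeriodicWord y l) (hdisj : ∀ u v, u ≠ v → Passes x u v → ¬ Passes y u v)
    (hdet : IsUnit (expDet (seqProd x 0 k) (seqProd y 0 l))) :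
    (∃ p, seqProd x 0 k = mk [p]) ∨ ∃ p, seqProd y 0 l = mk [p] := by
  have hdet' : IsUnit (expDet (seqProd y 0 l) (seqProd x 0 k)) := by
    rw [expDet_swap]; exact hdet.neg
  by_cases hxs : ∃ i j, (x i).2 ≠ (x j).2
  · have hys : ¬ ∃ i j, (y i).2 ≠ (y j).2 := fun h =>
      hdisj _ _ (by decide) (passes_of_sign hx hxs) (passes_of_sign hy h)
    by_cases hyt : ∃ i j, twistedSign (y i) ≠ twistedSign (y j)
    · have hxt : ¬ ∃ i j, twistedSign (x i) ≠ twistedSign (x j) := fun h =>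
        hdisj _ _ (by decide) (passes_of_twistedSign hx h) (passes_of_twistedSign hy hyt)
      exact absurd hdet' (not_isUnit_expDet (exponents_of_sign_const hy hys hyt)
        (exponents_of_twistedSign_const hx hxt hxs))
    · exact .inr (eq_letter_of_const hys hyt hdet')
  · by_cases hxt : ∃ i j, twistedSign (x i) ≠ twistedSign (x j)
    · have hyt : ¬ ∃ i j, twistedSign (y i) ≠ twistedSign (y j) := fun h =>
        hdisj _ _ (by decide) (passes_of_twistedSign hx hxt) (passes_of_twistedSign hy h)
      by_cases hys : ∃ i j, (y i).2 ≠ (y j).2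
      · exact absurd hdet (not_isUnit_expDet (exponents_of_sign_const hx hxs hxt)
          (exponents_of_twistedSign_const hy hyt hys))
      · exact .inr (eq_letter_of_const hys hyt hdet')
    · exact .inl (eq_letter_of_const hxs hxt hdet)

end FreeGroup

/-! ### Ping-pong for words, and the reduction to a single letter. -/

section

open FreeGroup OrientedCircle

namespace IsClassicalTSchottkyConfiguration

variable {n : ℕ} {C C' : Fin n → OrientedCircle} {g : Fin n → Moebius}

/-- The circle whose interior is the target of a letter. -/
def letterCircle (C C' : Fin n → OrientedCircle) (x : Fin n × Bool) : OrientedCircle :=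
  if x.2 then C' x.1 else C x.1

theorem disjoint_letterCircle (H : IsClassicalTSchottkyConfiguration C C' g) {x y : Fin n × Bool}
    (hxy : x ≠ y) :
    Disjoint (letterCircle C C' x).interior (letterCircle C C' y).interior := by
  obtain ⟨i, _ | _⟩ := x <;> obtain ⟨j, _ | _⟩ := y
  · exact H.disjoint_interiors (i := .inl i) (j := .inl j) (by simpa using hxy)
  · exact H.disjoint_interiors (i := .inl i) (j := .inr j) (by simp)
  · exact H.disjoint_interiors (i := .inr i) (j := .inl j) (by simp)
  · exact H.disjoint_interiors (i := .inr i) (j := .inr j) (by simpa using hxy)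

theorem letter_smul_mem (H : IsClassicalTSchottkyConfiguration C C' g) (x : Fin n × Bool)
    {z : OnePoint ℂ} (hz : z ∈ (letterCircle C C' (letterInv x)).exterior) :
    FreeGroup.lift g (FreeGroup.mk [x]) • z ∈ (letterCircle C C' x).interior := by
  have h : ∀ i, ∀ z ∈ (C i).exterior, g i • z ∈ (C' i).interior := fun i z hz =>
    H.side_pairing i ▸ Set.mem_image_of_mem (fun z => g i • z) hz
  obtain ⟨i, _ | _⟩ := x
  · simpa [letterCircle] using smul_inv_mem_interior (h i) hz
  · simpa [letterCircle] using h i z hz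

theorem seqProd_smul_mem (H : IsClassicalTSchottkyConfiguration C C' g) {x : ℕ → Fin n × Bool}
    (hx : ∀ i, x (i + 1) ≠ letterInv (x i)) (m i : ℕ) {z : OnePoint ℂ}
    (hz : z ∈ (letterCircle C C' (letterInv (x (i + m)))).exterior) :
    FreeGroup.lift g (seqProd x i (m + 1)) • z ∈ (letterCircle C C' (x i)).interior := by
  induction m generalizing i with
  | zero => simpa [seqProd] using H.letter_smul_mem (x i) hz
  | succ m ih =>
    rw [seqProd, _root_.map_mul, mul_smul]
    apply H.letter_smul_mem
    apply interior_subset_exterior (H.disjoint_letterCircle (hx i))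
    exact ih (i + 1) (by rwa [show i + 1 + m = i + (m + 1) by ring])

theorem exists_letter_ne (hn : 2 ≤ n) (u v : Fin n × Bool) : ∃ w : Fin n × Bool, w ≠ u ∧ w ≠ v := by
  by_contra! h
  have h1 : (Finset.univ : Finset (Fin n × Bool)) ⊆ {u, v} := by
    intro w _
    by_cases hw : w = u
    · simp [hw]
    · simp [h w hw]
  have h2 := (Finset.card_le_card h1).trans Finset.card_le_two
  simp at h2
  omega

/-- The test point lies in the disc of a third letter `w`. For `n = 1` the claim fails: the two
interiors may be complementary and `g 0` trivial. -/
theorem lift_injective (H : IsClassicalTSchottkyConfiguration C C' g) (hn : 2 ≤ n) :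
    Function.Injective (FreeGroup.lift g) := by
  rw [injective_iff_map_eq_one]
  intro s hs
  by_contra hne
  obtain ⟨x, k, c, hx, rfl⟩ := exists_isPeriodicWord hne
  obtain ⟨m, rfl⟩ := Nat.exists_eq_add_one_of_ne_zero hx.pos.ne'
  have h1 : FreeGroup.lift g (seqProd x 0 (m + 1)) = 1 := by
    simpa [mul_inv_eq_one] using hs
  obtain ⟨w, hw1, hw2⟩ := exists_letter_ne hn (letterInv (x (0 + m))) (x 0)
  obtain ⟨z, hz⟩ := (letterCircle C C' w).interior_nonempty
  have h2 := H.seqProd_smul_mem hx.reduced m 0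
    (interior_subset_exterior (H.disjoint_letterCircle hw1) hz)
  rw [h1, one_smul] at h2
  exact Set.disjoint_left.1 (H.disjoint_letterCircle hw2) hz h2

/-- Read from the letter after the turn, the period ends with `x i`. This conjugate maps the
exterior of the circle of `(x i)⁻¹` into the interior of that of `x (i + 1)`. -/
theorem exists_touching_fixedPoint (H : IsClassicalTSchottkyConfiguration C C' g)
    {x : ℕ → Fin n × Bool} {k : ℕ} (hx : IsPeriodicWord x k)
    (hp : (FreeGroup.lift g (seqProd x 0 k)).IsParabolic) {u v : Fin n × Bool}
    (h : Passes x u v) : ∃ (c : FreeGroup (Fin n)) (p : OnePoint ℂ),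
      FreeGroup.lift g (c * seqProd x 0 k * c⁻¹) • p = p ∧ (letterCircle C C' u).form p = 0 ∧
      (letterCircle C C' v).form p = 0 := by
  obtain ⟨i, hi⟩ := h
  obtain ⟨c, hc⟩ := hx.seqProd_conj (i + 1)
  have hpar : (FreeGroup.lift g (seqProd x (i + 1) k)).IsParabolic := by
    rw [hc, _root_.map_mul, _root_.map_mul, _root_.map_inv]
    exact hp.conj _
  obtain ⟨p, hfix⟩ := hpar.exists_fixedPoint
  obtain ⟨m, rfl⟩ := Nat.exists_eq_add_one_of_ne_zero hx.pos.ne'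
  obtain ⟨h1, h2⟩ := form_fixedPoint_eq_zero hpar hfix (H.disjoint_letterCircle (hx.reduced i))
    (fun z hz => H.seqProd_smul_mem hx.reduced m (i + 1) (by
      rwa [show i + 1 + m = i + (m + 1) by ring, hx.periodic]))
  refine ⟨c, p, by rwa [← hc], ?_⟩
  rcases hi with ⟨rfl, rfl⟩ | ⟨rfl, rfl⟩
  · exact ⟨h2, h1⟩
  · exact ⟨h1, h2⟩

end IsClassicalTSchottkyConfiguration

theorem Moebius.IsParabolic.ne_one {g : Moebius} (hg : g.IsParabolic) : g ≠ 1 := by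
  rintro rfl
  exact OnePoint.infty_ne_coe (0 : ℂ) (hg.fixedPoint_unique (one_smul _ _) (one_smul _ _))

theorem isSchottkyPair_of_letter {g : Fin 2 → Moebius} {i j : Fin 2} (hij : i ≠ j)
    (H : IsSchottkyPair (g i) (g j)) {ε : ℤ} (hε : ε = 1 ∨ ε = -1) {c t : FreeGroup (Fin 2)}
    (hgen : Subgroup.closure {c * of i ^ ε * c⁻¹, t} = ⊤) {S T : Moebius}
    (hS : FreeGroup.lift g (c * of i ^ ε * c⁻¹) = S) (hT : FreeGroup.lift g t = T)
    (hSp : S.IsParabolic) (hTp : T.IsParabolic)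
    (hST : ∀ z : OnePoint ℂ, ¬ (S • z = z ∧ T • z = z)) : IsSchottkyPair S T := by
  have hgen' : Subgroup.closure {of i, c⁻¹ * t * c} = ⊤ := by
    set K := Subgroup.closure {of i, c⁻¹ * t * c} with hK
    have hle : Subgroup.closure {c * of i ^ ε * c⁻¹, t} ≤
        K.comap (MulAut.conj c⁻¹).toMonoidHom := by
      rw [Subgroup.closure_le]
      rintro x (rfl | rfl)
      · simpa [mul_assoc] using zpow_mem (Subgroup.subset_closure (by simp : of i ∈ _)) ε
      · simpa [mul_assoc, hK] using
          Subgroup.subset_closure (by simp : c⁻¹ * x * c ∈ ({of i, c⁻¹ * x * c} : Set _))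
    rw [hgen] at hle
    rw [eq_top_iff]
    intro x _
    simpa [mul_assoc] using hle (Subgroup.mem_top (c * x * c⁻¹))
  obtain ⟨m, n, ht⟩ := exists_eq_of_closure_eq_top hij hgen'
  obtain ⟨b, hb, hT'⟩ : ∃ b, IsSchottkyPair (g i) b ∧
      T = FreeGroup.lift g c * (g i ^ m * b * g i ^ n) * (FreeGroup.lift g c)⁻¹ := by
    rcases ht with ht | ht
    · refine ⟨g j, H, ?_⟩
      rw [← hT, show t = c * (c⁻¹ * t * c) * c⁻¹ by group, ht]
      simp
    · refine ⟨(g j)⁻¹, H.inv_right, ?_⟩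
      rw [← hT, show t = c * (c⁻¹ * t * c) * c⁻¹ by group, ht]
      simp
  set a := g i with ha
  -- Conjugation by `a ^ m` fixes `a` and moves the left power of `a` in `T` to the right.
  set h := FreeGroup.lift g c * a ^ m with hh
  have hT2 : T = h * (b * a ^ (n + m)) * h⁻¹ := by rw [hT', hh]; group
  have hS2 : S = h * a ^ ε * h⁻¹ := by
    rw [← hS, hh]
    simp only [_root_.map_mul, _root_.map_inv, _root_.map_zpow, FreeGroup.lift_apply_of, ← ha]
    group
  have ha' : (h * a * h⁻¹ = S ∨ h * a * h⁻¹ = S⁻¹) := by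
    rcases hε with rfl | rfl
    · left; rw [hS2]; group
    · right; rw [hS2]; group
  have hpar : (h * a * h⁻¹).IsParabolic := by
    rcases ha' with e | e <;> rw [e]
    · exact hSp
    · exact hSp.inv
  have hpa : a.IsParabolic := by
    have := hpar.conj h⁻¹
    rwa [show h⁻¹ * (h * a * h⁻¹) * h⁻¹⁻¹ = a by group] at this
  have hpT : (b * a ^ (n + m)).IsParabolic := by
    have := hTp.conj h⁻¹
    rwa [hT2, show h⁻¹ * (h * (b * a ^ (n + m)) * h⁻¹) * h⁻¹⁻¹ = b * a ^ (n + m) by group] at this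
  have key := (isSchottkyPair_mul_zpow hb hpa (n + m) hpT (by
    rintro z ⟨h1, h2⟩
    apply hST (h • z)
    have h3 : (h * a * h⁻¹) • h • z = h • z := by
      rw [mul_smul, inv_smul_smul, mul_smul, h1]
    refine ⟨?_, by rw [hT2, mul_smul, inv_smul_smul, mul_smul, h2]⟩
    rcases ha' with e | e <;> rw [e] at h3
    · exact h3
    · exact (inv_smul_eq_iff.1 h3).symm)).conj h⁻¹
  rw [inv_inv, ← hT2] at key
  rcases ha' with e | e <;> rw [e] at key
  · exact key
  · simpa using key.inv_left

theorem isSchottkyPair_of_configuration {S T : Moebius} (hS : S.IsParabolic) (hT : T.IsParabolic)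
    (hST : ∀ z : OnePoint ℂ, ¬ (S • z = z ∧ T • z = z)) {C C' : Fin 2 → OrientedCircle}
    {g : Fin 2 → Moebius} (H : IsClassicalTSchottkyConfiguration C C' g)
    {s t : FreeGroup (Fin 2)} (hs : FreeGroup.lift g s = S) (ht : FreeGroup.lift g t = T)
    (hgen : Subgroup.closure {s, t} = ⊤) : IsSchottkyPair S T := by
  have hs1 : s ≠ 1 := by rintro rfl; exact hS.ne_one (by simpa using hs.symm)
  have ht1 : t ≠ 1 := by rintro rfl; exact hT.ne_one (by simpa using ht.symm)
  have hinj := H.lift_injective le_rfl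
  obtain ⟨x, k, c, hx, ec⟩ := exists_isPeriodicWord hs1
  obtain ⟨y, l, d, hy, ed⟩ := exists_isPeriodicWord ht1
  have hpx : (FreeGroup.lift g (seqProd x 0 k)).IsParabolic := by
    have := hS.conj (FreeGroup.lift g c)⁻¹
    rw [← hs, ec] at this
    convert this using 1
    simp only [_root_.map_mul, _root_.map_inv]
    group
  have hpy : (FreeGroup.lift g (seqProd y 0 l)).IsParabolic := by
    have := hT.conj (FreeGroup.lift g d)⁻¹
    rw [← ht, ed] at this
    convert this using 1
    simp only [_root_.map_mul, _root_.map_inv]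
    group
  have hunit : IsUnit (expDet (seqProd x 0 k) (seqProd y 0 l)) := by
    have := isUnit_expDet hgen
    rwa [ec, ed, expDet_conj] at this
  -- A common turn gives conjugates of `s` and `t` whose images share a fixed point. The images
  -- commute, hence so do the conjugates, and `expDet` would vanish.
  have hdisj : ∀ u v, u ≠ v → Passes x u v → ¬ Passes y u v := by
    intro u v huv hxp hyp
    obtain ⟨c', p, e1, p1, p2⟩ := H.exists_touching_fixedPoint hx hpx hxp
    obtain ⟨d', q, e2, q1, q2⟩ := H.exists_touching_fixedPoint hy hpy hyp
    obtain ⟨w, hw1, hw2⟩ := IsClassicalTSchottkyConfiguration.exists_letter_ne le_rfl u v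
    have hpq : p = q := touching_point_unique (H.disjoint_letterCircle huv)
      (H.disjoint_letterCircle hw1) (H.disjoint_letterCircle hw2) p1 p2 q1 q2
    subst hpq
    have hcomm := Moebius.IsParabolic.commute (by
      rw [_root_.map_mul, _root_.map_mul, _root_.map_inv]; exact hpx.conj _) (by
      rw [_root_.map_mul, _root_.map_mul, _root_.map_inv]; exact hpy.conj _) e1 e2
    have hc2 : Commute (c' * seqProd x 0 k * c'⁻¹) (d' * seqProd y 0 l * d'⁻¹) :=
      hinj (((_root_.map_mul _ _ _).trans hcomm.eq).trans (_root_.map_mul _ _ _).symm)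
    have h0 := expDet_eq_zero_of_commute hc2
    rw [expDet_conj] at h0
    rw [h0] at hunit
    exact not_isUnit_zero hunit
  have hpair : ∀ i j : Fin 2, i ≠ j → IsSchottkyPair (g i) (g j) := by
    have h01 : IsSchottkyPair (g 0) (g 1) := ⟨C, C', by
      have : ![g 0, g 1] = g := by ext i; fin_cases i <;> rfl
      rwa [this]⟩
    intro i j hij
    rcases (show (i = 0 ∧ j = 1) ∨ (i = 1 ∧ j = 0) by omega) with ⟨rfl, rfl⟩ | ⟨rfl, rfl⟩
    · exact h01
    · exact h01.swap
  have hother : ∀ i : Fin 2, ∃ j, i ≠ j := by decide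
  have hletter : ∀ p : Fin 2 × Bool, ∃ ε : ℤ, (ε = 1 ∨ ε = -1) ∧
      (FreeGroup.mk [p] : FreeGroup (Fin 2)) = of p.1 ^ ε := by
    intro p
    rcases mk_singleton_eq p with h | h
    · exact ⟨1, .inl rfl, by simpa using h⟩
    · exact ⟨-1, .inr rfl, by simpa using h⟩
  rcases exists_eq_letter hx hy hdisj hunit with ⟨p, hp⟩ | ⟨p, hp⟩
  · obtain ⟨ε, hε, e⟩ := hletter p
    obtain ⟨j, hj⟩ := hother p.1
    rw [hp, e] at ec
    rw [ec] at hs hgen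
    exact isSchottkyPair_of_letter hj (hpair _ _ hj) hε hgen hs ht hS hT hST
  · obtain ⟨ε, hε, e⟩ := hletter p
    obtain ⟨j, hj⟩ := hother p.1
    rw [hp, e] at ed
    rw [Set.pair_comm, ed] at hgen
    rw [ed] at ht
    exact (isSchottkyPair_of_letter hj (hpair _ _ hj) hε hgen ht hs hT hS
      (fun z hz => hST z hz.symm)).swap

end

theorem theorem6p7 (S T : Moebius) (hS : S.IsParabolic) (hT : T.IsParabolic)
    (hST : ∀ z : OnePoint ℂ, ¬ (S • z = z ∧ T • z = z)) :
    IsMarkedClassicalTSchottky (Subgroup.closure {S, T}) ![S, T] ↔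
      IsClassicalTSchottky (Subgroup.closure {S, T}) := by
  refine ⟨fun h => ⟨2, _, h⟩, ?_⟩
  rintro ⟨n, g, hG, C, C', H⟩
  refine ⟨by rw [Matrix.range_cons, Matrix.range_cons, Matrix.range_empty, Set.union_empty,
    Set.singleton_union], ?_⟩
  change IsSchottkyPair S T
  -- If they commuted, `T` would preserve the unique fixed point of `S`.
  have hncomm : ¬ Commute S T := by
    intro hc
    obtain ⟨p, hp⟩ := hS.exists_fixedPoint
    refine hST p ⟨hp, hS.fixedPoint_unique (p := T • p) ?_ hp⟩
    rw [← mul_smul, hc.eq, mul_smul, hp]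
  have hSm : S ∈ Subgroup.closure (Set.range g) := hG ▸ Subgroup.subset_closure (by simp)
  have hTm : T ∈ Subgroup.closure (Set.range g) := hG ▸ Subgroup.subset_closure (by simp)
  have hn : 2 ≤ n := by
    by_contra! hlt
    apply hncomm
    have hsub : (Set.range g).Subsingleton := by
      have : Subsingleton (Fin n) := Fin.subsingleton_iff_le_one.2 (by omega)
      exact Set.subsingleton_range g
    obtain ⟨g₀, hg₀⟩ : ∃ g₀, Set.range g ⊆ {g₀} := by
      rcases hsub.eq_empty_or_singleton with h | ⟨a, h⟩
      · exact ⟨1, by simp [h]⟩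
      · exact ⟨a, h.le⟩
    have hle := Subgroup.closure_mono hg₀
    obtain ⟨a, ha⟩ := Subgroup.mem_closure_singleton.1 (hle hSm)
    obtain ⟨b, hb⟩ := Subgroup.mem_closure_singleton.1 (hle hTm)
    rw [← ha, ← hb]
    exact (Commute.refl g₀).zpow_zpow a b
  have hinj := H.lift_injective hn
  have hrange := FreeGroup.range_lift_eq_closure (f := g)
  rw [← hrange] at hSm hTm
  obtain ⟨s, hs⟩ := hSm
  obtain ⟨t, ht⟩ := hTm
  have hgen : Subgroup.closure {s, t} = ⊤ := by
    apply Subgroup.map_injective hinj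
    rw [MonoidHom.map_closure, Set.image_pair, hs, ht, hG, ← hrange, MonoidHom.range_eq_map]
  obtain rfl : n = 2 := le_antisymm (FreeGroup.le_two_of_closure_eq_top hgen) hn
  exact isSchottkyPair_of_configuration hS hT hST H hs ht hgen
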